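/- Setting. Let $z_1,\dots,z_{n-1}\in\mathbb{C}$ be distinct, $z_n=\infty$, $S=\{z_1,\dots,z_n\}\subset\mathbb{CP}^1$, and $\zeta=1/z$. Let $N=\mathrm{diag}(m_1,\dots,m_r)$ with integers $m_1\le\dots\le m_r$, and let $E_N=\bigoplus_j\mathcal{O}(m_j)$ be the bundle on $\mathbb{CP}^1$ with transition function $g_{01}(z)=z^N$. An element of $\mathrm{Aut}(E_N)$ is a pair of holomorphic maps $g_0,g_1:\mathbb{C}\to\mathrm{GL}(r,\mathbb{C})$ with $g_0(z)=z^Ng_1(1/z)z^{-N}$ for $z\ne0$. Let $\mathcal{W}$ be given by weights $0\le\alpha_{i1}<\dots<\alpha_{ir}<1$, put $W_i=\mathrm{diag}(\alpha_{i1},\dots,\alpha_{ir})$ for $i=1,\dots,n$, and let $\mathbf{F}=(F_1,\dots,F_n)$ be complete descending flags in $\mathbb{C}^r$, regarded as flags in the fibers of $E_N$ over $z_1,\dots,z_n$ (in the trivialization over the chart $z$ for $i<n$, over the chart $\zeta$ for $i=n$). A logarithmic connection adapted to $(\mathbf{F},\mathcal{W})$ on $E_N$ is a form $A(z)=\bigl(\sum_{i=1}^{n-1}\frac{A_i}{z-z_i}+f_0(z)\bigr)dz$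 with $f_0$ entire, such that $z^{-N}A(z)z^N+N\,dz/z$ equals $(A_n/\zeta+\text{holomorphic})\,d\zeta$ near $\infty$ and such that for each $i=1,\dots,n$ there is $B_i\in\mathrm{GL}(r,\mathbb{C})$ with $A_i=B_iW_iB_i^{-1}$ whose columns $b_{i1},\dots,b_{ir}$ give $F_i$ (the $j$-th space of $F_i$ is spanned by $b_{ij},\dots,b_{ir}$). Let $\mathcal{A}_{\mathbf{F}}$ be the set of these. The group $\mathrm{Aut}(E_N)$ acts by $g\cdot A=g_0Ag_0^{-1}-dg_0\,g_0^{-1}$ and $g\cdot\mathbf{F}=(g_0(z_1)F_1,\dots,g_0(z_{n-1})F_{n-1},g_1(0)F_n)$. Let $\mathrm{P}_N$ be the group of invertible matrices whose $(j,k)$ entry vanishes whenever $m_j<m_k$, and let $F_{\mathrm{std}}$ be the flag of the standard basis $e_1,\dots,e_r$. Statement. Let $A\in\mathcal{A}_{\mathbf{F}}$. There is a permutation matrix $\Pi_n$ with $F_n\in \mathrm{P}_N\,\Pi_n\cdot F_{\mathrm{std}}$. For every such $\Pi_n$, with $N'=\Pi_n^{-1}N\Pi_n$, there is $g\in\mathrm{Aut}(E_N)$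 such that, near $z_n=\infty$, $$g\cdot A=\left(\frac{\Pi_n(W_n+N')\Pi_n^{-1}}{\zeta}+f_1'(\zeta)\right)d\zeta\qquad(f_1'\text{ holomorphic at }\zeta=0),$$ and for fixed $\Pi_n$ such a $g$ is unique up to left multiplication by a constant invertible diagonal matrix. For every such $g$: 1. $g\cdot A\in\mathcal{A}_{g\cdot\mathbf{F}}$; 2. $g\cdot A$ is a Fuchsian system on $\mathbb{CP}^1$: $g\cdot A=\sum_{i=1}^{n-1}\frac{A_i'}{z-z_i}\,dz$ with constant matrices $A_i'$, and $\sum_{i=1}^{n-1}A_i'=-\Pi_n(W_n+N')\Pi_n^{-1}$; 3. $g\cdot A$ has the same monodromy representation as $A$: for every base point $x_0\in\mathbb{CP}^1\setminus S$, analytic continuation of the fundamental solution of $dY+AY=0$ equal to the identity at $x_0$ defines a representation $\rho:\pi_1(\mathbb{CP}^1\setminus S,x_0)\to\mathrm{GL}(r,\mathbb{C})$, and the monodromy representation of $g\cdot A$ is $g_0(x_0)\,\rho\,g_0(x_0)^{-1}$. Thus $g\cdot A$ (the Riemann–Hilbert gauge) is a representative, in the $\mathrm{Aut}(E_N)$-orbit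 of $A$, that solves the Riemann–Hilbert problem for the monodromy representation of $A$. -/

import Mathlib

open Topology Filter
open scoped MatrixGroups

namespace RHGauge

/-! ### Matrices -/

/-- The space of complex `r × r` matrices. -/
abbrev Mat (r : ℕ) := Matrix (Fin r) (Fin r) ℂ

/-- A matrix-valued function all of whose entries are entire. -/
def IsEntire {r : ℕ} (f : ℂ → Mat r) : Prop :=
  ∀ a b, Differentiable ℂ (fun w => f w a b)

/-- A matrix-valued function all of whose entries are holomorphic near `0`. -/
def IsHolomorphicAtZero {r : ℕ} (f : ℂ → Mat r) : Prop :=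
  ∀ a b, AnalyticAt ℂ (fun w => f w a b) 0

/-- The entrywise complex derivative of a matrix-valued function. -/
noncomputable def matDeriv {r : ℕ} (f : ℂ → Mat r) (w : ℂ) : Mat r :=
  Matrix.of fun a b => deriv (fun u => f u a b) w

/-- The diagonal matrix `N` with integral entries `m`. -/
def splitMat {r : ℕ} (m : Fin r → ℤ) : Mat r := Matrix.diagonal fun j => (m j : ℂ)

/-- The diagonal matrix `w ^ N`, used for `w ≠ 0`. -/
noncomputable def powMat {r : ℕ} (m : Fin r → ℤ) (w : ℂ) : Mat r :=
  Matrix.diagonal fun j => w ^ m j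

/-- The diagonal matrix `W` of a row of weights. -/
def weightMat {r : ℕ} (a : Fin r → ℝ) : Mat r := Matrix.diagonal fun j => (a j : ℂ)

/-- The permutation matrix `Π`, with entries `Π j k = 1` if `k = σ j` and `0` otherwise,
as an element of the general linear group. -/
noncomputable def permGL {r : ℕ} (σ : Equiv.Perm (Fin r)) : GL (Fin r) ℂ where
  val := σ.permMatrix ℂ
  inv := σ⁻¹.permMatrix ℂ
  val_inv := by rw [← Matrix.permMatrix_mul]; simp
  inv_val := by rw [← Matrix.permMatrix_mul]; simp

/-- Conjugation `Ad(g)(X) = g X g⁻¹`. -/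
noncomputable def Ad {r : ℕ} (g : GL (Fin r) ℂ) (X : Mat r) : Mat r :=
  (g : Mat r) * X * ((g⁻¹ : GL (Fin r) ℂ) : Mat r)

/-! ### Complete descending flags -/

/-- A complete descending flag `ℂ^r = V 0 ⊃ V 1 ⊃ ⋯ ⊃ V (r-1) ⊃ {0}`. -/
@[ext] structure CompleteFlag (r : ℕ) where
  V : Fin r → Submodule ℂ (Fin r → ℂ)
  antitone : Antitone V
  finrank_eq : ∀ j, Module.finrank ℂ (V j) = r - j

/-- The flag of an ordered frame: `V j` is spanned by the columns `j, …, r-1` of `B`. -/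
noncomputable def flagOfFrame {r : ℕ} (B : GL (Fin r) ℂ) : CompleteFlag r where
  V j := Submodule.span ℂ ((fun l => (B : Mat r).col l) '' Set.Ici j)
  antitone := fun _ _ h => Submodule.span_mono (Set.image_mono (Set.Ici_subset_Ici.mpr h))
  finrank_eq := by
    intro j
    have hli : LinearIndependent ℂ (B : Mat r).col :=
      Matrix.linearIndependent_cols_of_isUnit B.isUnit
    have h2 : LinearIndependent ℂ (fun l : Set.Ici j => (B : Mat r).col l) :=
      hli.comp _ Subtype.val_injective
    rw [Set.image_eq_range, finrank_span_eq_card h2]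
    simp

/-- The left action of the general linear group on complete flags. -/
noncomputable def CompleteFlag.act {r : ℕ} (g : GL (Fin r) ℂ) (F : CompleteFlag r) :
    CompleteFlag r where
  V j := (F.V j).map (Matrix.mulVecLin (g : Mat r))
  antitone := fun _ _ h => Submodule.map_mono (F.antitone h)
  finrank_eq := by
    intro j
    have hinj : Function.Injective (Matrix.mulVecLin (g : Mat r)) := by
      rw [Matrix.coe_mulVecLin]
      exact Matrix.mulVec_injective_of_isUnit g.isUnit
    rw [← F.finrank_eq j]
    exact (Submodule.equivMapOfInjective _ hinj (F.V j)).finrank_eq.symm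

/-- The standard parabolic group `P_N`: the `(j, k)` entry vanishes if `m j < m k`.  For
nondecreasing `m` these are the block lower triangular matrices, with blocks given by the
multiplicities of the values of `m`. -/
def IsParabolic {r : ℕ} (m : Fin r → ℤ) (p : GL (Fin r) ℂ) : Prop :=
  ∀ j k, m j < m k → (p : Mat r) j k = 0

/-- The flag `F` lies in the `P_N`-orbit `P_N · Π · F_std` of the translate by `Π` of the
standard descending flag. -/
def InCell {r : ℕ} (m : Fin r → ℤ) (σ : Equiv.Perm (Fin r)) (F : CompleteFlag r) : Prop :=
  ∃ p : GL (Fin r) ℂ, IsParabolic m p ∧ F = flagOfFrame (p * permGL σ)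

/-! ### Automorphisms of the split bundle `E_N = 𝒪(m 0) ⊕ ⋯ ⊕ 𝒪(m (r-1))` -/

/-- An automorphism of the bundle over the Riemann sphere with transition function
`g₀₁(z) = z ^ N`: a pair of holomorphic maps on the two affine charts, with coordinates `z` and
`ζ = 1 / z`. -/
structure BundleAut {r : ℕ} (m : Fin r → ℤ) where
  g0 : ℂ → GL (Fin r) ℂ
  g1 : ℂ → GL (Fin r) ℂ
  holo0 : IsEntire fun w => (g0 w : Mat r)
  holo1 : IsEntire fun w => (g1 w : Mat r)
  glue : ∀ w : ℂ, w ≠ 0 →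
    (g0 w : Mat r) = powMat m w * (g1 w⁻¹ : Mat r) * powMat (fun j => -m j) w

/-- The gauge action `g · A = g A g⁻¹ - dg g⁻¹`, in the chart `z`, on the coefficient of a
connection form `A(z) dz`. -/
noncomputable def BundleAut.act {r : ℕ} {m : Fin r → ℤ} (g : BundleAut m) (A : ℂ → Mat r) :
    ℂ → Mat r := fun w =>
  Ad (g.g0 w) (A w) -
    matDeriv (fun u => (g.g0 u : Mat r)) w * (((g.g0 w)⁻¹ : GL (Fin r) ℂ) : Mat r)

/-- The action on tuples of flags in the fibers over `z 0, …, z (k-1)` (in the trivialization over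
the chart `z`) and over `∞` (last index, in the trivialization over the chart `ζ`). -/
noncomputable def BundleAut.actFlags {r k : ℕ} {m : Fin r → ℤ} (g : BundleAut m) (z : Fin k → ℂ)
    (F : Fin (k + 1) → CompleteFlag r) : Fin (k + 1) → CompleteFlag r :=
  Fin.lastCases (motive := fun _ => CompleteFlag r)
    ((F (Fin.last k)).act (g.g1 0)) (fun i => (F i.castSucc).act (g.g0 (z i)))

/-! ### Logarithmic connections -/

/-- The coefficient of `dζ`, `ζ = 1 / z`, in the pullback of the form `A(z) dz` to the chart at
infinity, with no change of frame. -/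
noncomputable def formAtInfty {r : ℕ} (A : ℂ → Mat r) (ζ : ℂ) : Mat r :=
  (-(ζ ^ 2)⁻¹) • A ζ⁻¹

/-- The coefficient of `dζ`, `ζ = 1 / z`, in `z^{-N} A(z) z^N dz + N dz / z`, which is the local
form of the connection in the trivialization over the chart at infinity. -/
noncomputable def connAtInfty {r : ℕ} (m : Fin r → ℤ) (A : ℂ → Mat r) (ζ : ℂ) : Mat r :=
  powMat m ζ * formAtInfty A ζ * powMat (fun j => -m j) ζ - ζ⁻¹ • splitMat m

/-- `A(z) dz` is the local form over `ℂ` of a logarithmic connection on `E_N` with poles at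
`z 0, …, z (k-1)` and `∞`, adapted to the flags `F` and the weights `α` (the last index
belongs to `∞`).  Only the values of `A` off the poles matter. -/
def IsAdaptedConnection {r k : ℕ} (m : Fin r → ℤ) (z : Fin k → ℂ) (α : Fin (k + 1) → Fin r → ℝ)
    (F : Fin (k + 1) → CompleteFlag r) (A : ℂ → Mat r) : Prop :=
  ∃ R : Fin (k + 1) → Mat r,
    (∃ f₀ : ℂ → Mat r, IsEntire f₀ ∧
      ∀ w, w ∉ Set.range z → A w = ∑ i : Fin k, (w - z i)⁻¹ • R i.castSucc + f₀ w) ∧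
    (∃ f₁ : ℂ → Mat r, IsHolomorphicAtZero f₁ ∧
      ∀ᶠ ζ in 𝓝[≠] (0 : ℂ), connAtInfty m A ζ = ζ⁻¹ • R (Fin.last k) + f₁ ζ) ∧
    ∀ i, ∃ B : GL (Fin r) ℂ, R i = Ad B (weightMat (α i)) ∧ F i = flagOfFrame B

/-- The matrix `Ad(Π)(W + N')`, where `N' = Ad(Π⁻¹)(N)`. -/
noncomputable def normalResidue {r : ℕ} (m : Fin r → ℤ) (a : Fin r → ℝ)
    (σ : Equiv.Perm (Fin r)) : Mat r :=
  Ad (permGL σ) (weightMat a + Ad (permGL σ)⁻¹ (splitMat m))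

/-- Over the chart `z`, the form `A(z) dz` expands near infinity as
`(Ad(Π)(W + N') / ζ + f(ζ)) dζ` with `f` holomorphic at `ζ = 0`. -/
def IsNormalizedAtInfty {r : ℕ} (m : Fin r → ℤ) (a : Fin r → ℝ) (σ : Equiv.Perm (Fin r))
    (A : ℂ → Mat r) : Prop :=
  ∃ f : ℂ → Mat r, IsHolomorphicAtZero f ∧
    ∀ᶠ ζ in 𝓝[≠] (0 : ℂ), formAtInfty A ζ = ζ⁻¹ • normalResidue m a σ + f ζ

/-- `d + A(z) dz` is the Fuchsian system on the Riemann sphere with poles in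
`{z 0, …, z (k-1), ∞}` and residues `R i` at the finite poles `z i`. -/
def IsFuchsianSystem {r k : ℕ} (z : Fin k → ℂ) (A : ℂ → Mat r) (R : Fin k → Mat r) : Prop :=
  ∀ w, w ∉ Set.range z → A w = ∑ i, (w - z i)⁻¹ • R i

/-! ### Monodromy -/

/-- The sphere punctured at `z 0, …, z (k-1)` and `∞`. -/
abbrev Punctured {k : ℕ} (z : Fin k → ℂ) := {w : ℂ // w ∉ Set.range z}

/-- `Y` is the analytic continuation along `γ` of a matrix solution of `dY + A Y = 0`: near every
parameter it is the restriction to `γ` of a holomorphic matrix solution on an open set. -/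
def IsContinuation {r k : ℕ} (z : Fin k → ℂ) (A : ℂ → Mat r) {x y : Punctured z} (γ : Path x y)
    (Y : unitInterval → Mat r) : Prop :=
  ∀ t : unitInterval, ∃ Φ : ℂ → Mat r,
    (∀ᶠ w in 𝓝 ((γ t : Punctured z) : ℂ),
      ∀ a b, HasDerivAt (fun u => Φ u a b) (-(A w * Φ w) a b) w) ∧
    ∀ᶠ s in 𝓝 t, Y s = Φ (γ s : Punctured z)

/-- `ρ` is the monodromy representation, based at `x₀`, of the connection `d + A(z) dz`: the class
of a loop is sent to the end value of the continuation along it of the solution that starts at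
the identity.  (In Mathlib's fundamental group, `p * q` is the class of `q` followed by `p`.) -/
def IsMonodromyRep {r k : ℕ} (z : Fin k → ℂ) (A : ℂ → Mat r) (x₀ : Punctured z)
    (ρ : FundamentalGroup (Punctured z) x₀ →* GL (Fin r) ℂ) : Prop :=
  ∀ γ : Path x₀ x₀, ∃ Y : unitInterval → Mat r, IsContinuation z A γ Y ∧ Y 0 = 1 ∧
    Y 1 = (ρ (FundamentalGroup.fromPath (Path.Homotopic.Quotient.mk γ)) : Mat r)

end RHGauge

/-! Near infinity the connection is `P(ζ) dζ / ζ` in the frame of the chart `ζ`. Returning to the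
frame of the chart `z` multiplies the entry `(i, j)` by `ζ ^ (m j - m i)`, so the off-diagonal terms
of `P` that spoil the normal form are the monomials `ζ ^ e E i j` with `e ≤ m i - m j`. These are
the very monomials for which `1 + c ζ ^ e E i j` is a global automorphism (`BundleAut.elementary`):
there is one gauge parameter for each obstruction.

The flag at infinity is put in position first. Row reduction (Bruhat decomposition, `exists_inCell`)
yields `σ`, and a constant parabolic gauge makes the residue triangular in the order given by `σ`,
with the weights on the diagonal (`exists_triangular_gauge`). Then `1 + c ζ ^ e E i j` changes the
coefficient of `ζ ^ e E i j` by `-c (e + α (σ i) - α (σ j))`. This factor is nonzero, because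
distinct weights in `[0, 1)` never differ by an integer (`int_add_sub_ne_zero`). The additive degree
`weightDeg` orders the monomials so that killing one leaves all others of the same or smaller degree
intact (`exists_elementary_normalization`). Only finitely many monomials obstruct, so finitely many
steps suffice.

Uniqueness rests on the same nonresonance. If `h` carries one normal form to another with the same
residue `D`, the lowest coefficient `C` of `h.g0 ζ⁻¹`, at `ζ ^ (-n)`, satisfies `(n + D j - D i) C i
j = 0`. Hence there is no pole, `h.g0` is constant by Liouville, and the constant is diagonal
(`BundleAut.eq_diagonal_of_normalized`).

A normalized form has only a simple pole at infinity in the chart `z`, so its entire part tends to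
zero there and vanishes by Liouville (`isFuchsianSystem_of_formAtInfty`). For the monodromy, local
power series solutions are assembled into a covering of the punctured sphere and paths are lifted
(`exists_isMonodromyRep`); a gauge transformation multiplies solutions by `g0`, which conjugates the
representation. -/

namespace RHGauge

/-! ### Power series solutions of linear differential equations -/

section LinearODE

variable {E : Type*} [NormedRing E] [NormedAlgebra ℂ E]

/-- The coefficients of the power series solution of `Y' = A Y`, `Y(0) = 1`. -/
noncomputable def solCoeff (a : ℕ → E) : ℕ → E
  | 0 => 1
  | n + 1 => ((n : ℂ) + 1)⁻¹ • ∑ i : Fin (n + 1), a (n - i) * solCoeff a i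
decreasing_by exact i.isLt

theorem solCoeff_zero (a : ℕ → E) : solCoeff a 0 = 1 := by rw [solCoeff]

theorem solCoeff_succ (a : ℕ → E) (n : ℕ) :
    ((n : ℂ) + 1) • solCoeff a (n + 1) =
      ∑ i ∈ Finset.range (n + 1), a i * solCoeff a (n - i) := by
  have h : ((n : ℂ) + 1) ≠ 0 := by exact_mod_cast n.succ_ne_zero
  rw [solCoeff, smul_smul, mul_inv_cancel₀ h, one_smul,
    Fin.sum_univ_eq_sum_range (fun i => a (n - i) * solCoeff a i),
    ← Finset.sum_range_reflect]
  refine Finset.sum_congr rfl fun i hi => ?_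
  have := Finset.mem_range.1 hi
  congr 2; omega

/-- The factor `n + 1` in the recursion cancels the number of terms of the convolution, and `M ≤ q`
turns the remaining `M` into one more power of `q`. -/
theorem norm_solCoeff_le {a : ℕ → E} {M q : ℝ} (hM : 0 ≤ M) (hMq : M ≤ q)
    (ha : ∀ n, ‖a n‖ ≤ M * q ^ n) (n : ℕ) : ‖solCoeff a n‖ ≤ ‖(1 : E)‖ * q ^ n := by
  have hq : 0 ≤ q := hM.trans hMq
  induction n using Nat.strong_induction_on with
  | _ n ih =>
    rcases n with _ | n
    · simp [solCoeff_zero]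
    · have h : (0 : ℝ) < (n : ℝ) + 1 := by positivity
      have h1 : ((n : ℝ) + 1) * ‖solCoeff a (n + 1)‖ ≤
          ((n : ℝ) + 1) * (‖(1 : E)‖ * q ^ (n + 1)) := by
        calc ((n : ℝ) + 1) * ‖solCoeff a (n + 1)‖
            = ‖((n : ℂ) + 1) • solCoeff a (n + 1)‖ := by
              rw [norm_smul]; congr 1
              rw [← Nat.cast_add_one, ← Nat.cast_add_one, Complex.norm_natCast]
          _ ≤ ∑ i ∈ Finset.range (n + 1), M * (‖(1 : E)‖ * q ^ n) := by
              rw [solCoeff_succ]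
              refine (norm_sum_le _ _).trans (Finset.sum_le_sum fun i hi => ?_)
              have hi' := Finset.mem_range.1 hi
              refine (norm_mul_le _ _).trans ?_
              calc ‖a i‖ * ‖solCoeff a (n - i)‖
                  ≤ (M * q ^ i) * (‖(1 : E)‖ * q ^ (n - i)) :=
                    mul_le_mul (ha i) (ih _ (by omega)) (norm_nonneg _) (by positivity)
                _ = M * (‖(1 : E)‖ * (q ^ i * q ^ (n - i))) := by ring
                _ = _ := by rw [← pow_add, Nat.add_sub_cancel' (by omega)]
          _ = ((n : ℝ) + 1) * (M * (‖(1 : E)‖ * q ^ n)) := by simp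
          _ ≤ ((n : ℝ) + 1) * (q * (‖(1 : E)‖ * q ^ n)) := by gcongr
          _ = _ := by ring
      exact le_of_mul_le_mul_left h1 h

/-- Geometric bounds on the coefficients of `A` pass to those of the formal solution. With `q = max
C s` both series are dominated by `q ^ n`; on the ball of radius `1 / (2 q)` everything converges
normally, so differentiation is termwise and the product is a Cauchy product. -/
theorem exists_hasDerivAt_mul [CompleteSpace E] {A : ℂ → E} {c : ℂ} (hA : AnalyticAt ℂ A c) :
    ∃ Y : ℂ → E, Y c = 1 ∧ ∀ᶠ w in 𝓝 c, HasDerivAt Y (A w * Y w) w := by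
  obtain ⟨p, R, hp⟩ := hA
  obtain ⟨C, s, hC, hs, hCs⟩ := p.le_mul_pow_of_radius_pos (hp.r_pos.trans_le hp.r_le)
  set a : ℕ → E := fun n => p.coeff n with ha
  set q : ℝ := max C s with hq
  have hqpos : 0 < q := lt_max_of_lt_left hC
  have han : ∀ n, ‖a n‖ ≤ C * q ^ n := fun n =>
    (p.norm_apply_eq_norm_coef (n := n) ▸ hCs n).trans (by gcongr; exact le_max_right _ _)
  have hbn := norm_solCoeff_le hC.le (le_max_left C s) han
  set b := solCoeff a with hb
  set K := ‖(1 : E)‖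
  have h2q : 0 < 1 / (2 * q) := by positivity
  set g : ℕ → ℂ → E := fun n y => (y - c) ^ n • b n with hg
  set g' : ℕ → ℂ → E := fun n y => ((n : ℂ) * (y - c) ^ (n - 1)) • b n with hg'
  have hmem : ∀ y ∈ Metric.ball c (1 / (2 * q)), ‖y - c‖ ≤ 1 / (2 * q) := fun y hy =>
    (mem_ball_iff_norm.1 hy).le
  have hball : ∀ (x : ℕ → E) (D : ℝ), (∀ n, ‖x n‖ ≤ D * q ^ n) → ∀ y ∈ Metric.ball c (1 / (2 * q)),
      ∀ n, ‖(y - c) ^ n • x n‖ ≤ D * (1 / 2) ^ n := by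
    intro x D hx y hy n
    rw [norm_smul, norm_pow]
    calc ‖y - c‖ ^ n * ‖x n‖ ≤ (1 / (2 * q)) ^ n * (D * q ^ n) := by
          gcongr
          · exact hmem y hy
          · exact hx n
      _ = D * ((1 / (2 * q)) * q) ^ n := by rw [mul_pow]; ring
      _ = _ := by congr 2; field_simp
  -- Majorant for the differentiated series; the factor 2 accounts for the exponent `n - 1` of `y -
  -- c`.
  have hu : Summable fun n : ℕ => K * q * (2 * (n * (1 / 2 : ℝ) ^ n)) := by
    refine Summable.mul_left _ (Summable.mul_left _ ?_)
    simpa using summable_pow_mul_geometric_of_norm_lt_one 1 (r := (1 / 2 : ℝ)) (by norm_num)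
  have hgb : ∀ n, ∀ y ∈ Metric.ball c (1 / (2 * q)),
      ‖g' n y‖ ≤ K * q * (2 * (n * (1 / 2 : ℝ) ^ n)) := by
    intro n y hy
    rcases n with _ | n
    · simp [hg']
    · simp only [hg', norm_smul, norm_mul, norm_pow, Complex.norm_natCast, Nat.add_sub_cancel]
      calc ((n + 1 : ℕ) : ℝ) * ‖y - c‖ ^ n * ‖b (n + 1)‖
          ≤ ((n + 1 : ℕ) : ℝ) * (1 / (2 * q)) ^ n * (K * q ^ (n + 1)) := by
            gcongr
            · exact hmem y hy
            · exact hbn _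
        _ = ((n + 1 : ℕ) : ℝ) * (K * q) * ((1 / (2 * q)) * q) ^ n := by rw [mul_pow]; ring
        _ = ((n + 1 : ℕ) : ℝ) * (K * q) * (1 / 2) ^ n := by congr 2; field_simp
        _ = _ := by ring
  have hgs : ∀ y ∈ Metric.ball c (1 / (2 * q)), Summable fun n => ‖g n y‖ := fun y hy =>
    Summable.of_nonneg_of_le (fun _ => norm_nonneg _) (hball b K hbn y hy)
      ((summable_geometric_of_lt_one (by norm_num) (by norm_num)).mul_left _)
  have hcmem : c ∈ Metric.ball c (1 / (2 * q)) := Metric.mem_ball_self h2q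
  refine ⟨fun y => ∑' n, g n y, ?_, ?_⟩
  · change ∑' n, g n c = 1
    rw [tsum_eq_single 0]
    · simp [hg, hb, solCoeff_zero]
    · intro n hn
      simp [hg, hn]
  · filter_upwards [Metric.ball_mem_nhds c h2q, Metric.eball_mem_nhds c hp.r_pos] with y hy hyR
    have hd := hasDerivAt_tsum_of_isPreconnected hu Metric.isOpen_ball
      (convex_ball c (1 / (2 * q))).isPreconnected (g := g) (g' := g')
      (fun n y _ => by
        have := (((hasDerivAt_id y).sub_const c).pow n).smul_const (b n)
        simpa [hg, hg'] using this) hgb hcmem (hgs c hcmem).of_norm hy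
    -- The equation is now an identity of series. The term `g' 0` vanishes, so after a shift of
    -- index it is the recursion `solCoeff_succ`.
    suffices h : A y * ∑' n, g n y = ∑' n, g' n y by
      change HasDerivAt _ (A y * ∑' n, g n y) y
      rw [h]
      exact hd
    have hAy : A y = ∑' n, (y - c) ^ n • a n := by
      have := (hp.hasSum (y := y - c) (by simpa [edist_eq_enorm_sub] using hyR)).tsum_eq
      rw [add_sub_cancel] at this
      rw [← this]
      exact tsum_congr fun n => by rw [p.apply_eq_pow_smul_coeff]
    have hAs : Summable fun n => ‖(y - c) ^ n • a n‖ :=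
      Summable.of_nonneg_of_le (fun _ => norm_nonneg _) (hball a C han y hy)
        ((summable_geometric_of_lt_one (by norm_num) (by norm_num)).mul_left _)
    rw [hAy, tsum_mul_tsum_eq_tsum_sum_range_of_summable_norm hAs (hgs y hy),
      (Summable.of_norm_bounded hu (fun n => hgb n y hy)).tsum_eq_zero_add]
    have : g' 0 y = 0 := by simp [hg']
    rw [this, zero_add]
    refine tsum_congr fun n => ?_
    have : g' (n + 1) y = (y - c) ^ n • (((n : ℂ) + 1) • b (n + 1)) := by
      simp only [hg', Nat.add_sub_cancel, smul_smul]
      push_cast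
      congr 1; ring
    rw [this, hb, solCoeff_succ, Finset.smul_sum]
    refine Finset.sum_congr rfl fun i hi => ?_
    have hi' := Finset.mem_range.1 hi
    simp only [hg, smul_mul_smul_comm, ← pow_add]
    rw [Nat.add_sub_cancel' (by omega)]

end LinearODE

/-! ### Matrix equations with entrywise holomorphic coefficients -/

section MatrixODE

attribute [local instance] Matrix.linftyOpNormedRing Matrix.linftyOpNormedAlgebra

theorem exists_matrix_solution {r : ℕ} {A : ℂ → Mat r} {c : ℂ}
    (hA : ∀ a b, AnalyticAt ℂ (fun w => A w a b) c) :
    ∃ Y : ℂ → Mat r, Y c = 1 ∧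
      ∀ᶠ w in 𝓝 c, ∀ a b, HasDerivAt (fun u => Y u a b) ((A w * Y w) a b) w := by
  have hA' : AnalyticAt ℂ A c := by
    have : A = fun w => ∑ a, ∑ b, A w a b • Matrix.single a b (1 : ℂ) := by
      ext1 w
      conv_lhs => rw [Matrix.matrix_eq_sum_single (A w)]
      simp [Matrix.smul_single]
    rw [this]
    refine Finset.analyticAt_fun_sum _ fun a _ => Finset.analyticAt_fun_sum _ fun b _ => ?_
    exact (hA a b).smul analyticAt_const
  obtain ⟨Y, hY, hd⟩ := exists_hasDerivAt_mul hA'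
  refine ⟨Y, hY, hd.mono fun w hw a b => ?_⟩
  exact (LinearMap.toContinuousLinearMap (Matrix.entryLinearMap ℂ ℂ a b)).hasFDerivAt.comp_hasDerivAt
    w hw

end MatrixODE

/-! ### Local fundamental solutions and their inverses -/

theorem hasDerivAt_matrix_mul {r : ℕ} {M N : ℂ → Mat r} {M' N' : Mat r} {w : ℂ}
    (hM : ∀ a b, HasDerivAt (fun u => M u a b) (M' a b) w)
    (hN : ∀ a b, HasDerivAt (fun u => N u a b) (N' a b) w) (a b : Fin r) :
    HasDerivAt (fun u => (M u * N u) a b) ((M' * N w + M w * N') a b) w := by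
  simp only [Matrix.mul_apply, Matrix.add_apply, ← Finset.sum_add_distrib]
  exact HasDerivAt.fun_sum fun c _ => (hM a c).mul (hN c b)

theorem eventually_eq_of_hasDerivAt_zero {f : ℂ → ℂ} {c : ℂ}
    (h : ∀ᶠ w in 𝓝 c, HasDerivAt f 0 w) : ∀ᶠ w in 𝓝 c, f w = f c := by
  obtain ⟨ε, hε, hb⟩ := Metric.eventually_nhds_iff_ball.1 h
  filter_upwards [Metric.ball_mem_nhds c hε] with w hw
  exact Metric.isOpen_ball.is_const_of_deriv_eq_zero (convex_ball c ε).isPreconnected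
    (fun x hx => (hb x hx).differentiableAt.differentiableWithinAt)
    (fun x hx => (hb x hx).deriv) hw (Metric.mem_ball_self hε)

/-- A fundamental solution `Φ` of `dY + A Y = 0` near `c`, normalized at `c`, with its inverse
`Ψ`. -/
structure LocalFrame {r : ℕ} (A : ℂ → Mat r) (c : ℂ) where
  Φ : ℂ → Mat r
  Ψ : ℂ → Mat r
  s : Set ℂ
  isOpen : IsOpen s
  mem : c ∈ s
  apply_self : Φ c = 1
  deriv_Φ : ∀ w ∈ s, ∀ a b, HasDerivAt (fun u => Φ u a b) (-(A w * Φ w) a b) w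
  deriv_Ψ : ∀ w ∈ s, ∀ a b, HasDerivAt (fun u => Ψ u a b) ((Ψ w * A w) a b) w
  mul_eq_one : ∀ w ∈ s, Ψ w * Φ w = 1

/-- The inverse is not computed from `Φ`: it is found as a solution of the adjoint equation `Ψ' = Ψ
A`, obtained by transposition. Then `Ψ Φ` has zero derivative and equals `1` at `c`. -/
theorem exists_localFrame {r : ℕ} {A : ℂ → Mat r} {c : ℂ}
    (hA : ∀ a b, AnalyticAt ℂ (fun w => A w a b) c) : Nonempty (LocalFrame A c) := by
  obtain ⟨Φ, hΦ, hΦd⟩ := exists_matrix_solution (A := fun w => -A w) (c := c)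
    fun a b => (hA a b).neg
  obtain ⟨Θ, hΘ, hΘd⟩ := exists_matrix_solution (A := fun w => (A w).transpose) (c := c)
    fun a b => hA b a
  have hΨd : ∀ᶠ w in 𝓝 c, ∀ a b,
      HasDerivAt (fun u => (Θ u).transpose a b) (((Θ w).transpose * A w) a b) w := by
    filter_upwards [hΘd] with w hw a b
    have := hw b a
    rwa [← Matrix.transpose_apply ((A w).transpose * Θ w), Matrix.transpose_mul,
      Matrix.transpose_transpose] at this
  have hconst : ∀ᶠ w in 𝓝 c, (Θ w).transpose * Φ w = 1 := by
    have h0 : ∀ a b, ∀ᶠ w in 𝓝 c,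
        HasDerivAt (fun u => ((Θ u).transpose * Φ u) a b) 0 w := by
      intro a b
      filter_upwards [hΦd, hΨd] with w h1 h2
      have := hasDerivAt_matrix_mul (M := fun u => (Θ u).transpose) h2 h1 a b
      simpa [Matrix.mul_assoc] using this
    have h1 : ∀ᶠ w in 𝓝 c, ∀ a b,
        ((Θ w).transpose * Φ w) a b = ((Θ c).transpose * Φ c) a b :=
      eventually_all.2 fun a => eventually_all.2 fun b => eventually_eq_of_hasDerivAt_zero (h0 a b)
    filter_upwards [h1] with w hw
    have : (Θ w).transpose * Φ w = (Θ c).transpose * Φ c := Matrix.ext hw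
    rw [this, hΦ, hΘ]; simp
  obtain ⟨s, hs, hso, hsc⟩ := eventually_nhds_iff.1 ((hΦd.and hΨd).and hconst)
  exact ⟨⟨Φ, fun u => (Θ u).transpose, s, hso, hsc, hΦ,
    fun w hw a b => by simpa using (hs w hw).1.1 a b, fun w hw => (hs w hw).1.2,
    fun w hw => (hs w hw).2⟩⟩

/-- Matrices with the discrete topology: the fiber of the covering of local solutions. -/
def DiscreteMat (r : ℕ) := Mat r

/-- The underlying matrix. -/
def DiscreteMat.toMat {r : ℕ} (v : DiscreteMat r) : Mat r := v

instance (r : ℕ) : TopologicalSpace (DiscreteMat r) := ⊥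
instance (r : ℕ) : DiscreteTopology (DiscreteMat r) := ⟨rfl⟩

/-! ### The covering of local solutions and its monodromy -/

section Covering

variable {r k : ℕ} {z : Fin k → ℂ} {A : ℂ → Mat r}

/-- The covering of the punctured sphere by the values of local solutions of `dY + A Y = 0`. -/
noncomputable def solutionBundle (S : ∀ c : Punctured z, LocalFrame A c) :
    FiberBundleCore (Punctured z) (Punctured z) (DiscreteMat r) where
  baseSet i := (fun w : Punctured z => (w : ℂ)) ⁻¹' (S i).s
  isOpen_baseSet i := (S i).isOpen.preimage continuous_subtype_val
  indexAt := id
  mem_baseSet_at i := (S i).mem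
  -- In the chart `i` the coordinate of a local solution is the constant `C` with `Y = Φ C`. At the
  -- base point of a chart `Φ` is `1`, so the fiber over `x`, read in the chart indexed by `x`,
  -- consists of the values at `x`.
  coordChange i j x v := ((S j).Ψ x * (S i).Φ x * v.toMat : Mat r)
  coordChange_self i x hx v := by
    rw [(S i).mul_eq_one _ hx, one_mul]; rfl
  continuousOn_coordChange i j := by
    rintro ⟨x, v⟩ ⟨⟨hi, hj⟩, -⟩
    refine ContinuousAt.continuousWithinAt ?_
    -- `Ψ Φ` is locally constant for two frames of the same equation; since the fiber is discrete,
    -- this gives continuity of the transition.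
    have h0 : ∀ a b, ∀ᶠ w in 𝓝 (x : ℂ),
        HasDerivAt (fun u => ((S j).Ψ u * (S i).Φ u) a b) 0 w := by
      intro a b
      filter_upwards [(S i).isOpen.mem_nhds hi, (S j).isOpen.mem_nhds hj] with w h1 h2
      have := hasDerivAt_matrix_mul (N' := -(A w * (S i).Φ w)) ((S j).deriv_Ψ w h2)
        ((S i).deriv_Φ w h1) a b
      simpa [Matrix.mul_assoc] using this
    have h1 : ∀ᶠ w in 𝓝 (x : ℂ), ∀ a b,
        ((S j).Ψ w * (S i).Φ w) a b = ((S j).Ψ x * (S i).Φ x) a b :=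
      eventually_all.2 fun a => eventually_all.2 fun b => eventually_eq_of_hasDerivAt_zero (h0 a b)
    have h2 : ∀ᶠ p : Punctured z × DiscreteMat r in 𝓝 (x, v),
        ((S j).Ψ p.1 * (S i).Φ p.1) = ((S j).Ψ x * (S i).Φ x) :=
      ((continuous_subtype_val.comp continuous_fst).tendsto (x, v)).eventually
        (h1.mono fun w hw => Matrix.ext hw)
    have h3 : ∀ᶠ p : Punctured z × DiscreteMat r in 𝓝 (x, v), p.2 = v :=
      (continuous_snd.tendsto (x, v)).eventually (p := fun y => y = v) (by simp)
    let y : DiscreteMat r := ((S j).Ψ x * (S i).Φ x * v.toMat : Mat r)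
    have hy : ContinuousAt (fun _ : Punctured z × DiscreteMat r => y) (x, v) := continuousAt_const
    refine hy.congr ?_
    filter_upwards [h2, h3] with p hp hp'
    rw [hp, hp']
  coordChange_comp i j k x hx v := by
    have h := mul_eq_one_comm.1 ((S j).mul_eq_one _ hx.1.2)
    change (S k).Ψ x * (S j).Φ x * ((S j).Ψ x * (S i).Φ x * v.toMat) =
      (S k).Ψ x * (S i).Φ x * v.toMat
    dsimp only at h
    rw [show (S k).Ψ x * (S j).Φ x * ((S j).Ψ x * (S i).Φ x * v.toMat) =
      (S k).Ψ x * ((S j).Φ x * (S j).Ψ x) * (S i).Φ x * v.toMat by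
        simp only [Matrix.mul_assoc], h, mul_one]

variable (S : ∀ c : Punctured z, LocalFrame A c)

/-- A value at `x` as a point of the covering of local solutions. -/
noncomputable def solutionPoint (x : Punctured z) (C : Mat r) : (solutionBundle S).TotalSpace :=
  ⟨x, C⟩

/-- The value of a point of the covering of local solutions. -/
noncomputable def solutionValue (e : (solutionBundle S).TotalSpace) : Mat r := e.2

theorem isCoveringMap_solutionBundle : IsCoveringMap (solutionBundle S).proj :=
  FiberBundle.isCoveringMap (F := DiscreteMat r) (E := (solutionBundle S).Fiber)

theorem localTriv_solutionBundle (i : Punctured z) (e : (solutionBundle S).TotalSpace) :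
    ((solutionBundle S).localTriv i e).2 =
      ((S i).Ψ e.1 * (S e.1).Φ e.1 * solutionValue S e : Mat r) := rfl

theorem localTriv_solutionBundle' (i : Punctured z) (e : (solutionBundle S).TotalSpace) :
    ((solutionBundle S).localTriv i e).2 = ((S i).Ψ e.1 * solutionValue S e : Mat r) := by
  rw [localTriv_solutionBundle, (S e.1).apply_self, mul_one]

/-- A continuous coordinate with values in a discrete space is locally constant. -/
theorem eventually_localTriv (e : (solutionBundle S).TotalSpace) :
    ∀ᶠ e' in 𝓝 e, (S e.1).Ψ e'.1 * solutionValue S e' = (S e.1).Ψ e.1 * solutionValue S e := by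
  have hc : ContinuousAt (fun e' => ((solutionBundle S).localTriv e.1 e').2) e := by
    refine continuous_snd.continuousAt.comp
      (((solutionBundle S).localTriv e.1).continuousAt ?_)
    exact (S e.1).mem
  have := hc.eventually (p := fun y => y = ((solutionBundle S).localTriv e.1 e).2) (by simp)
  filter_upwards [this] with e' he'
  rwa [localTriv_solutionBundle', localTriv_solutionBundle'] at he'

/-- A lift stays locally in one sheet, and a sheet is the graph of a single solution `Φ C`. -/
theorem isContinuation_of_lift {x y : Punctured z} (γ : Path x y)
    {Γ : unitInterval → (solutionBundle S).TotalSpace} (hΓ : Continuous Γ)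
    (hp : ∀ t, (Γ t).1 = γ t) : IsContinuation z A γ fun t => solutionValue S (Γ t) := by
  intro t
  set c := (Γ t).1 with hc
  set C := (S c).Ψ c * solutionValue S (Γ t) with hC
  refine ⟨fun u => (S c).Φ u * C, ?_, ?_⟩
  · rw [← hp]
    filter_upwards [(S c).isOpen.mem_nhds (S c).mem] with w hw a b
    have := hasDerivAt_matrix_mul (N := fun _ => C) (M' := -(A w * (S c).Φ w)) (N' := 0)
      ((S c).deriv_Φ w hw) (fun a b => hasDerivAt_const _ _) a b
    simpa [Matrix.mul_assoc] using this
  · have h1 := (hΓ.tendsto t).eventually (eventually_localTriv S (Γ t))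
    have h2 : ∀ᶠ s in 𝓝 t, ((γ s : Punctured z) : ℂ) ∈ (S c).s := by
      refine (continuous_subtype_val.comp γ.continuous).continuousAt.eventually
        ((S c).isOpen.mem_nhds ?_)
      simp only [Function.comp, ← hp]
      exact (S c).mem
    filter_upwards [h1, h2] with s hs hs'
    rw [← hp] at hs' ⊢
    rw [hC, ← hs, ← Matrix.mul_assoc, mul_eq_one_comm.1 ((S c).mul_eq_one _ hs'), one_mul]

/-- Right multiplication by a constant matrix on the covering of local solutions. -/
noncomputable def solutionMulRight (C : Mat r) (e : (solutionBundle S).TotalSpace) :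
    (solutionBundle S).TotalSpace := solutionPoint S e.1 (solutionValue S e * C)

theorem continuous_solutionMulRight (C : Mat r) : Continuous (solutionMulRight S C) := by
  rw [continuous_iff_continuousAt]
  intro e
  rw [FiberBundle.continuousAt_totalSpace]
  refine ⟨(isCoveringMap_solutionBundle S).continuous.continuousAt (x := e), ?_⟩
  have h := eventually_localTriv S e
  let y : DiscreteMat r := ((S e.1).Ψ e.1 * solutionValue S e * C : Mat r)
  have hy : ContinuousAt (fun _ : (solutionBundle S).TotalSpace => y) e := continuousAt_const
  refine hy.congr ?_
  filter_upwards [h] with e' he'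
  have h3 : (S e.1).Ψ e'.1 * (solutionValue S e' * C) =
      (S e.1).Ψ e.1 * solutionValue S e * C := by rw [← Matrix.mul_assoc, he']
  exact h3.symm.trans (localTriv_solutionBundle' S e.1 (solutionMulRight S C e')).symm

/-- Right multiplication by a constant commutes with the projection, so it carries lifts to lifts,
and lifts are unique. -/
theorem liftPath_solutionMulRight (C : Mat r) (γ : C(unitInterval, Punctured z))
    (e : (solutionBundle S).TotalSpace) (h : γ 0 = (solutionBundle S).proj e) :
    solutionMulRight S C ((isCoveringMap_solutionBundle S).liftPath γ e h 1) =
      (isCoveringMap_solutionBundle S).liftPath γ (solutionMulRight S C e) h 1 := by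
  have hc := isCoveringMap_solutionBundle S
  have : solutionMulRight S C ∘ hc.liftPath γ e h = hc.liftPath γ (solutionMulRight S C e) h := by
    refine (hc.eq_liftPath_iff (e := solutionMulRight S C e) h).2 ⟨(continuous_solutionMulRight S C).comp (hc.liftPath γ e h).continuous, ?_, ?_⟩
    · exact hc.liftPath_lifts γ e h
    · simp [hc.liftPath_zero]
  exact congrFun this 1

/-- The monodromy of the covering of local solutions, as a homomorphism to the monoid of
matrices. -/
noncomputable def monodromyHom (x₀ : Punctured z) :
    FundamentalGroup (Punctured z) x₀ →* Mat r where
  toFun p := solutionValue S ((isCoveringMap_solutionBundle S).monodromy (x := x₀) (y := x₀) p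
    ⟨solutionPoint S x₀ 1, rfl⟩).1
  map_one' := by
    rw [FundamentalGroup.one_def, IsCoveringMap.monodromy_refl]
    rfl
  map_mul' p q := by
    have hc := isCoveringMap_solutionBundle S
    rw [FundamentalGroup.mul_def, IsCoveringMap.monodromy_trans_apply]
    induction p using Path.Homotopic.Quotient.ind with | mk p => ?_
    generalize hc.monodromy (x := x₀) (y := x₀) q ⟨solutionPoint S x₀ 1, rfl⟩ = e
    -- Continuation along `q` ends at `e`, which is the identity times the value of `e`. Continuing
    -- from there along `p` is therefore the continuation from the identity, multiplied on the right
    -- by that value: this gives the order `ρ p * ρ q`.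
    have h1 : solutionMulRight S (solutionValue S e.1) (solutionPoint S x₀ 1) = e.1 := by
      obtain ⟨⟨x, v⟩, hx⟩ := e
      obtain rfl : x = x₀ := hx
      change solutionPoint S _ (1 * _) = _
      rw [one_mul]; rfl
    have h2 := liftPath_solutionMulRight S (solutionValue S e.1) (p : C(unitInterval, Punctured z))
      (solutionPoint S x₀ 1) p.source
    change solutionValue S (hc.liftPath _ e.1 _ 1) =
      solutionValue S (hc.liftPath _ (solutionPoint S x₀ 1) _ 1) * solutionValue S e.1
    simp only [h1] at h2
    rw [← h2]
    rfl

end Covering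

/-- The monodromy representation of a connection that is holomorphic off the punctures. -/
theorem exists_isMonodromyRep {r k : ℕ} {z : Fin k → ℂ} {A : ℂ → Mat r}
    (hA : ∀ c : Punctured z, ∀ a b, AnalyticAt ℂ (fun w => A w a b) c) (x₀ : Punctured z) :
    ∃ ρ : FundamentalGroup (Punctured z) x₀ →* GL (Fin r) ℂ, IsMonodromyRep z A x₀ ρ := by
  let S : ∀ c : Punctured z, LocalFrame A c := fun c => (exists_localFrame (hA c)).some
  -- A homomorphism from a group to a monoid takes values in the units, so invertibility needs no
  -- separate argument.
  refine ⟨(monodromyHom S x₀).toHomUnits, fun γ => ?_⟩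
  have hc := isCoveringMap_solutionBundle S
  refine ⟨fun t => solutionValue S (hc.liftPath γ (solutionPoint S x₀ 1) γ.source t),
    isContinuation_of_lift S γ (hc.liftPath γ _ _).continuous
      (congrFun (hc.liftPath_lifts γ _ γ.source)), ?_, rfl⟩
  exact congrArg (solutionValue S) (hc.liftPath_zero (γ : C(unitInterval, Punctured z))
    (solutionPoint S x₀ 1) γ.source)

variable {r : ℕ}

/-! ### Entrywise calculus -/

theorem matDeriv_eq {f : ℂ → Mat r} {f' : Mat r} {w : ℂ}
    (h : ∀ a b, HasDerivAt (fun u => f u a b) (f' a b) w) : matDeriv f w = f' :=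
  Matrix.ext fun a b => (h a b).deriv

theorem IsEntire.hasDerivAt {f : ℂ → Mat r} (hf : IsEntire f) (w : ℂ) (a b : Fin r) :
    HasDerivAt (fun u => f u a b) (matDeriv f w a b) w :=
  (hf a b w).hasDerivAt

theorem IsEntire.mul {f g : ℂ → Mat r} (hf : IsEntire f) (hg : IsEntire g) :
    IsEntire fun w => f w * g w := fun a b w =>
  (hasDerivAt_matrix_mul (hf.hasDerivAt w) (hg.hasDerivAt w) a b).differentiableAt

theorem IsEntire.add {f g : ℂ → Mat r} (hf : IsEntire f) (hg : IsEntire g) :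
    IsEntire fun w => f w + g w := fun a b => (hf a b).add (hg a b)

theorem IsEntire.sub {f g : ℂ → Mat r} (hf : IsEntire f) (hg : IsEntire g) :
    IsEntire fun w => f w - g w := fun a b => (hf a b).sub (hg a b)

theorem IsEntire.sum {ι : Type*} (s : Finset ι) {f : ι → ℂ → Mat r} (hf : ∀ i, IsEntire (f i)) :
    IsEntire fun w => ∑ i ∈ s, f i w := fun a b => by
  simp only [Matrix.sum_apply]
  exact Differentiable.fun_sum fun i _ => hf i a b

theorem isEntire_const (C : Mat r) : IsEntire fun _ => C := fun _ _ => differentiable_const _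

theorem isEntire_matDeriv {f : ℂ → Mat r} (hf : IsEntire f) : IsEntire (matDeriv f) :=
  fun a b => (hf a b).deriv

theorem IsEntire.isHolomorphicAtZero {f : ℂ → Mat r} (hf : IsEntire f) : IsHolomorphicAtZero f :=
  fun a b => (hf a b).analyticAt 0

theorem matDeriv_mul {f g : ℂ → Mat r} (hf : IsEntire f) (hg : IsEntire g) (w : ℂ) :
    matDeriv (fun u => f u * g u) w = matDeriv f w * g w + f w * matDeriv g w :=
  matDeriv_eq (hasDerivAt_matrix_mul (hf.hasDerivAt w) (hg.hasDerivAt w))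

theorem IsEntire.det {n : Type*} [Fintype n] [DecidableEq n] {f : ℂ → Matrix n n ℂ}
    (hf : ∀ a b, Differentiable ℂ fun w => f w a b) : Differentiable ℂ fun w => (f w).det := by
  simp only [Matrix.det_apply]
  exact Differentiable.fun_sum fun σ _ =>
    (Differentiable.fun_finsetProd fun i _ => hf _ _).const_smul _

/-- Cramer's rule: the adjugate is entire and the determinant has no zeros. -/
theorem IsEntire.inv {g : ℂ → GL (Fin r) ℂ} (hg : IsEntire fun w => (g w : Mat r)) :
    IsEntire fun w => (((g w)⁻¹ : GL (Fin r) ℂ) : Mat r) := by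
  intro a b
  have hdet : Differentiable ℂ fun w => (g w : Mat r).det := IsEntire.det hg
  have hadj : Differentiable ℂ fun w => (g w : Mat r).adjugate a b := by
    simp only [Matrix.adjugate_apply]
    refine IsEntire.det fun c d => ?_
    by_cases hc : c = b
    · subst hc
      simp
    · simpa [Matrix.updateRow_apply, hc] using hg c d
  have : (fun w => (((g w)⁻¹ : GL (Fin r) ℂ) : Mat r) a b) =
      fun w => ((g w : Mat r).det)⁻¹ * (g w : Mat r).adjugate a b := by
    ext w
    rw [Matrix.coe_units_inv, Matrix.inv_def, Ring.inverse_eq_inv]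
    rfl
  rw [this]
  exact (hdet.inv fun w => ((Matrix.isUnit_iff_isUnit_det _).1 (g w).isUnit).ne_zero).mul hadj

/-! ### Powers of a parameter -/

theorem powMat_mul_powMat_neg (m : Fin r → ℤ) {w : ℂ} (hw : w ≠ 0) :
    powMat m w * powMat (fun j => -m j) w = 1 := by
  simp [powMat, zpow_neg, hw, zpow_ne_zero, Matrix.diagonal_mul_diagonal]

theorem powMat_neg_mul_powMat (m : Fin r → ℤ) {w : ℂ} (hw : w ≠ 0) :
    powMat (fun j => -m j) w * powMat m w = 1 :=
  mul_eq_one_comm.1 (powMat_mul_powMat_neg m hw)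

theorem powMat_inv (m : Fin r → ℤ) (w : ℂ) : powMat m w⁻¹ = powMat (fun j => -m j) w := by
  simp [powMat]

theorem powMat_neg_inv (m : Fin r → ℤ) (w : ℂ) : powMat (fun j => -m j) w⁻¹ = powMat m w := by
  simp [powMat]

theorem powMat_conj_apply (m : Fin r → ℤ) {w : ℂ} (hw : w ≠ 0) (X : Mat r) (a b : Fin r) :
    (powMat m w * X * powMat (fun j => -m j) w) a b = w ^ (m a - m b) * X a b := by
  simp only [powMat, Matrix.mul_diagonal, Matrix.diagonal_mul]
  rw [sub_eq_add_neg, zpow_add₀ hw]; ring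

theorem powMat_neg_conj_apply (m : Fin r → ℤ) {w : ℂ} (hw : w ≠ 0) (X : Mat r) (a b : Fin r) :
    (powMat (fun j => -m j) w * X * powMat m w) a b = w ^ (m b - m a) * X a b := by
  simp only [powMat, Matrix.mul_diagonal, Matrix.diagonal_mul]
  rw [sub_eq_neg_add, zpow_add₀ hw]; ring

/-! ### The group of automorphisms -/

namespace BundleAut

variable {m : Fin r → ℤ}

theorem g0_inv_eq (g : BundleAut m) {ζ : ℂ} (hζ : ζ ≠ 0) :
    (g.g0 ζ⁻¹ : Mat r) = powMat (fun j => -m j) ζ * g.g1 ζ * powMat m ζ := by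
  rw [g.glue _ (inv_ne_zero hζ), powMat_inv, powMat_neg_inv, inv_inv]

theorem coe_inv_g0 (g : BundleAut m) {w : ℂ} (hw : w ≠ 0) :
    (((g.g0 w)⁻¹ : GL (Fin r) ℂ) : Mat r) =
      powMat m w * (((g.g1 w⁻¹)⁻¹ : GL (Fin r) ℂ) : Mat r) * powMat (fun j => -m j) w := by
  refine Units.inv_eq_of_mul_eq_one_right ?_
  rw [g.glue w hw]
  calc _ = powMat m w * g.g1 w⁻¹ * (powMat (fun j => -m j) w * powMat m w) *
        (((g.g1 w⁻¹)⁻¹ : GL (Fin r) ℂ) : Mat r) * powMat (fun j => -m j) w := by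
        simp only [Matrix.mul_assoc]
    _ = powMat m w * (g.g1 w⁻¹ * (((g.g1 w⁻¹)⁻¹ : GL (Fin r) ℂ) : Mat r)) *
        powMat (fun j => -m j) w := by
        rw [powMat_neg_mul_powMat m hw]; simp only [Matrix.mul_assoc, one_mul]
    _ = 1 := by rw [Units.mul_inv, mul_one, powMat_mul_powMat_neg m hw]

/-- The composition of automorphisms. -/
noncomputable def mul (h g : BundleAut m) : BundleAut m where
  g0 w := h.g0 w * g.g0 w
  g1 w := h.g1 w * g.g1 w
  holo0 := by simpa using h.holo0.mul g.holo0
  holo1 := by simpa using h.holo1.mul g.holo1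
  glue w hw := by
    rw [Units.val_mul, Units.val_mul, h.glue w hw, g.glue w hw]
    calc _ = powMat m w * h.g1 w⁻¹ * (powMat (fun j => -m j) w * powMat m w) *
          g.g1 w⁻¹ * powMat (fun j => -m j) w := by simp only [Matrix.mul_assoc]
      _ = _ := by rw [powMat_neg_mul_powMat m hw, mul_one]; simp only [Matrix.mul_assoc]

/-- The inverse of an automorphism. -/
noncomputable def inv (g : BundleAut m) : BundleAut m where
  g0 w := (g.g0 w)⁻¹
  g1 w := (g.g1 w)⁻¹
  holo0 := IsEntire.inv g.holo0
  holo1 := IsEntire.inv g.holo1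
  glue _ hw := g.coe_inv_g0 hw

theorem act_mul_g0 (g : BundleAut m) (A : ℂ → Mat r) (w : ℂ) :
    g.act A w * g.g0 w = g.g0 w * A w - matDeriv (fun u => (g.g0 u : Mat r)) w := by
  rw [act, Ad, sub_mul, Matrix.mul_assoc, Units.inv_mul, mul_one, Matrix.mul_assoc, Units.inv_mul,
    mul_one]

theorem act_mul (h g : BundleAut m) (A : ℂ → Mat r) : (h.mul g).act A = h.act (g.act A) := by
  ext1 w
  have hu : IsUnit ((h.mul g).g0 w : Mat r) := ((h.mul g).g0 w).isUnit
  refine hu.mul_right_cancel ?_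
  have e : ((h.mul g).g0 w : Mat r) = h.g0 w * g.g0 w := rfl
  rw [act_mul_g0]
  have hd : matDeriv (fun u => ((h.mul g).g0 u : Mat r)) w =
      matDeriv (fun u => (h.g0 u : Mat r)) w * g.g0 w +
        h.g0 w * matDeriv (fun u => (g.g0 u : Mat r)) w := matDeriv_mul h.holo0 g.holo0 w
  rw [hd, e, ← Matrix.mul_assoc, act_mul_g0, sub_mul, Matrix.mul_assoc _ (g.act A w), act_mul_g0,
    mul_sub, Matrix.mul_assoc]
  abel

/-- Differentiation of the gluing relation. The commutator with `N` comes from the powers `w ^ (m a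
- m b)`, the last term from `ζ = 1 / w`. -/
theorem matDeriv_g0_inv (g : BundleAut m) {ζ : ℂ} (hζ : ζ ≠ 0) :
    powMat m ζ * matDeriv (fun u => (g.g0 u : Mat r)) ζ⁻¹ * powMat (fun j => -m j) ζ =
      ζ • (splitMat m * (g.g1 ζ : Mat r) - (g.g1 ζ : Mat r) * splitMat m) -
        ζ ^ 2 • matDeriv (fun u => (g.g1 u : Mat r)) ζ := by
  have hw : ζ⁻¹ ≠ 0 := inv_ne_zero hζ
  ext a b
  rw [powMat_conj_apply m hζ]
  have h1 : HasDerivAt (fun u => (g.g0 u : Mat r) a b)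
      (((m a - m b : ℤ) : ℂ) * ζ⁻¹ ^ (m a - m b - 1) * (g.g1 ζ : Mat r) a b +
        ζ⁻¹ ^ (m a - m b) * (matDeriv (fun u => (g.g1 u : Mat r)) ζ a b * -(ζ⁻¹ ^ 2)⁻¹)) ζ⁻¹ := by
    have hg1 := g.holo1.hasDerivAt ζ a b
    have hg1' : HasDerivAt (fun u : ℂ => (g.g1 u⁻¹ : Mat r) a b)
        (matDeriv (fun u => (g.g1 u : Mat r)) ζ a b * -(ζ⁻¹ ^ 2)⁻¹) ζ⁻¹ := by
      refine HasDerivAt.comp (h₂ := fun u => (g.g1 u : Mat r) a b) ζ⁻¹ ?_ (hasDerivAt_inv hw)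
      simpa using hg1
    have h2 := (hasDerivAt_zpow (m a - m b) ζ⁻¹ (Or.inl hw)).mul hg1'
    rw [inv_inv] at h2
    refine h2.congr_of_eventuallyEq ?_
    filter_upwards [isOpen_ne.mem_nhds hw] with u hu
    rw [g.glue u hu, powMat_conj_apply m hu]
    rfl
  rw [show matDeriv (fun u => (g.g0 u : Mat r)) ζ⁻¹ a b = _ from h1.deriv]
  simp only [Matrix.sub_apply, Matrix.smul_apply, splitMat, Matrix.mul_diagonal,
    Matrix.diagonal_mul, smul_eq_mul]
  rw [zpow_sub_one₀ hw, inv_zpow, inv_inv]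
  have hz : ζ ^ (m a - m b) ≠ 0 := zpow_ne_zero _ hζ
  push_cast
  field_simp
  ring

/-- The gauge action has the same shape in both charts: the commutator of `N` with `g1` produced by
the derivative is absorbed by the term `-N / ζ` of the local form at infinity. -/
theorem connAtInfty_act (g : BundleAut m) (A : ℂ → Mat r) {ζ : ℂ} (hζ : ζ ≠ 0) :
    connAtInfty m (g.act A) ζ = Ad (g.g1 ζ) (connAtInfty m A ζ) -
      matDeriv (fun u => (g.g1 u : Mat r)) ζ * (((g.g1 ζ)⁻¹ : GL (Fin r) ℂ) : Mat r) := by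
  have hD := g.matDeriv_g0_inv hζ
  have h1 := powMat_mul_powMat_neg m hζ
  have h3 : powMat m ζ * (g.g0 ζ⁻¹ : Mat r) = g.g1 ζ * powMat m ζ := by
    rw [g.g0_inv_eq hζ, ← Matrix.mul_assoc, ← Matrix.mul_assoc, h1, one_mul]
  have h4 : (((g.g0 ζ⁻¹)⁻¹ : GL (Fin r) ℂ) : Mat r) * powMat (fun j => -m j) ζ =
      powMat (fun j => -m j) ζ * (((g.g1 ζ)⁻¹ : GL (Fin r) ℂ) : Mat r) := by
    rw [g.coe_inv_g0 (inv_ne_zero hζ), inv_inv, powMat_inv, powMat_neg_inv, Matrix.mul_assoc,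
      h1, mul_one]
  set Z := powMat m ζ
  set Z' := powMat (fun j => -m j) ζ
  set G := (g.g1 ζ : Mat r) with hG
  set G' := matDeriv (fun u => (g.g1 u : Mat r)) ζ
  set Gi := (((g.g1 ζ)⁻¹ : GL (Fin r) ℂ) : Mat r)
  set D := matDeriv (fun u => (g.g0 u : Mat r)) ζ⁻¹
  set X := A ζ⁻¹
  have hGG : G * Gi = 1 := Units.mul_inv _
  have e1 : connAtInfty m (g.act A) ζ =
      -(ζ ^ 2)⁻¹ • (G * (Z * X * Z') * Gi - Z * D * Z' * Gi) - ζ⁻¹ • splitMat m := by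
    rw [connAtInfty, formAtInfty, act, Ad]
    change Z * (-(ζ ^ 2)⁻¹ • (_ * X * _ - D * _)) * Z' - _ = _
    rw [mul_smul_comm, smul_mul_assoc, mul_sub, sub_mul]
    congr 3
    · calc _ = (Z * (g.g0 ζ⁻¹ : Mat r)) * X *
            ((((g.g0 ζ⁻¹)⁻¹ : GL (Fin r) ℂ) : Mat r) * Z') := by simp only [Matrix.mul_assoc]
        _ = _ := by rw [h3, h4]; simp only [Matrix.mul_assoc]
    · simp only [Matrix.mul_assoc, h4]
  have e2 : Ad (g.g1 ζ) (connAtInfty m A ζ) =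
      G * (-(ζ ^ 2)⁻¹ • (Z * X * Z') - ζ⁻¹ • splitMat m) * Gi := by
    rw [Ad, connAtInfty, formAtInfty, mul_smul_comm, smul_mul_assoc]
  have e3 : splitMat m = splitMat m * G * Gi := by rw [Matrix.mul_assoc, hGG, mul_one]
  rw [e1, e2, hD]
  conv_lhs => rw [show ζ⁻¹ • splitMat m = ζ⁻¹ • (splitMat m * G * Gi) by rw [← e3]]
  simp only [mul_sub, sub_mul, smul_sub, mul_smul_comm, smul_mul_assoc, smul_smul, neg_smul,
    neg_mul, mul_neg]
  have hz1 : (ζ ^ 2)⁻¹ * ζ = ζ⁻¹ := by field_simp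
  have hz2 : (ζ ^ 2)⁻¹ * ζ ^ 2 = 1 := by field_simp
  rw [hz1, hz2, one_smul]
  abel

end BundleAut

variable {k : ℕ}

/-! ### Holomorphic germs of matrices -/

theorem IsHolomorphicAtZero.mul {f g : ℂ → Mat r} (hf : IsHolomorphicAtZero f)
    (hg : IsHolomorphicAtZero g) : IsHolomorphicAtZero fun w => f w * g w := fun a b => by
  simp only [Matrix.mul_apply]
  exact Finset.analyticAt_fun_sum _ fun c _ => (hf a c).mul (hg c b)

theorem IsHolomorphicAtZero.add {f g : ℂ → Mat r} (hf : IsHolomorphicAtZero f)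
    (hg : IsHolomorphicAtZero g) : IsHolomorphicAtZero fun w => f w + g w :=
  fun a b => (hf a b).add (hg a b)

theorem IsHolomorphicAtZero.sub {f g : ℂ → Mat r} (hf : IsHolomorphicAtZero f)
    (hg : IsHolomorphicAtZero g) : IsHolomorphicAtZero fun w => f w - g w :=
  fun a b => (hf a b).sub (hg a b)

theorem IsHolomorphicAtZero.smul {f : ℂ → Mat r} (hf : IsHolomorphicAtZero f) :
    IsHolomorphicAtZero fun w => w • f w :=
  fun a b => analyticAt_id.mul (hf a b)

theorem IsHolomorphicAtZero.continuousAt {f : ℂ → Mat r} (hf : IsHolomorphicAtZero f) :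
    ContinuousAt f 0 :=
  continuousAt_pi.2 fun a => continuousAt_pi.2 fun b => (hf a b).continuousAt

theorem isHolomorphicAtZero_const (C : Mat r) : IsHolomorphicAtZero fun _ => C :=
  fun _ _ => analyticAt_const

theorem exists_eq_mul_of_zero {f : ℂ → ℂ} (hf : AnalyticAt ℂ f 0) (h0 : f 0 = 0) :
    ∃ h : ℂ → ℂ, AnalyticAt ℂ h 0 ∧ ∀ ζ, f ζ = ζ * h ζ := by
  obtain ⟨p, hp⟩ := hf
  refine ⟨dslope f 0, ⟨_, hp.has_fpower_series_dslope_fslope⟩, fun ζ => ?_⟩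
  have := sub_smul_dslope f 0 ζ
  simp only [sub_zero, h0, smul_eq_mul] at this
  exact this.symm

theorem IsHolomorphicAtZero.exists_eq_smul {f : ℂ → Mat r} (hf : IsHolomorphicAtZero f)
    (h0 : f 0 = 0) : ∃ h : ℂ → Mat r, IsHolomorphicAtZero h ∧ ∀ ζ, f ζ = ζ • h ζ := by
  choose h hh he using fun a b => exists_eq_mul_of_zero (hf a b) (by rw [h0]; rfl)
  exact ⟨fun ζ => Matrix.of fun a b => h a b ζ, fun a b => hh a b,
    fun ζ => Matrix.ext fun a b => he a b ζ⟩

theorem IsHolomorphicAtZero.exists_smul_eq {f : ℂ → Mat r} (hf : IsHolomorphicAtZero f) :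
    ∃ h : ℂ → Mat r, IsHolomorphicAtZero h ∧ ∀ ζ, ζ ≠ 0 → ζ⁻¹ • f ζ = ζ⁻¹ • f 0 + h ζ := by
  obtain ⟨h, hh, he⟩ := (hf.sub (isHolomorphicAtZero_const (f 0))).exists_eq_smul (sub_self _)
  refine ⟨h, hh, fun ζ hζ => ?_⟩
  have := he ζ
  rw [sub_eq_iff_eq_add] at this
  rw [this, smul_add, smul_smul, inv_mul_cancel₀ hζ, one_smul, add_comm]

theorem IsEntire.exists_smul_eq {f : ℂ → Mat r} (hf : IsEntire f) (c : ℂ) :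
    ∃ h : ℂ → Mat r, IsEntire h ∧
      ∀ w, w ≠ c → (w - c)⁻¹ • f w = (w - c)⁻¹ • f c + h w := by
  refine ⟨fun w => Matrix.of fun a b => dslope (fun u => f u a b) c w, fun a b => ?_,
    fun w hw => Matrix.ext fun a b => ?_⟩
  · have := (Complex.differentiableOn_dslope (c := c) univ_mem).2 (hf a b).differentiableOn
    exact differentiableOn_univ.1 this
  · simp only [Matrix.smul_apply, Matrix.add_apply, Matrix.of_apply, dslope_of_ne _ hw, slope,
      vsub_eq_sub, smul_eq_mul]
    ring

/-- Liouville's theorem, in the coordinate at infinity. -/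
theorem eq_const_of_tendsto_inv {f : ℂ → ℂ} (hf : Differentiable ℂ f) {c : ℂ}
    (h : Tendsto (fun ζ => f ζ⁻¹) (𝓝[≠] 0) (𝓝 c)) (w : ℂ) : f w = c := by
  refine hf.apply_eq_of_tendsto_cocompact w ?_
  rw [← Metric.cobounded_eq_cocompact]
  simpa [Function.comp_def] using h.comp (tendsto_inv₀_cobounded' (α := ℂ))

theorem IsEntire.eq_const_of_tendsto_inv {f : ℂ → Mat r} (hf : IsEntire f) {C : Mat r}
    (h : Tendsto (fun ζ => f ζ⁻¹) (𝓝[≠] 0) (𝓝 C)) (w : ℂ) : f w = C :=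
  Matrix.ext fun a b => RHGauge.eq_const_of_tendsto_inv (hf a b)
    (tendsto_pi_nhds.1 (tendsto_pi_nhds.1 h a) b) w

/-! ### Conjugation -/

theorem Ad_mul (g h : GL (Fin r) ℂ) (X : Mat r) : Ad (g * h) X = Ad g (Ad h X) := by
  simp only [Ad, Units.val_mul, mul_inv_rev, Matrix.mul_assoc]

theorem Ad_add (g : GL (Fin r) ℂ) (X Y : Mat r) : Ad g (X + Y) = Ad g X + Ad g Y := by
  simp only [Ad, mul_add, add_mul]

theorem Ad_smul (g : GL (Fin r) ℂ) (c : ℂ) (X : Mat r) : Ad g (c • X) = c • Ad g X := by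
  simp only [Ad, mul_smul_comm, smul_mul_assoc]

theorem Ad_sum {ι : Type*} (s : Finset ι) (g : GL (Fin r) ℂ) (X : ι → Mat r) :
    Ad g (∑ i ∈ s, X i) = ∑ i ∈ s, Ad g (X i) := by
  simp only [Ad, Finset.mul_sum, Finset.sum_mul]

theorem Ad_one (X : Mat r) : Ad 1 X = X := by simp [Ad]

theorem Ad_permGL (σ : Equiv.Perm (Fin r)) (X : Mat r) :
    Ad (permGL σ) X = X.submatrix σ σ := by
  change σ.permMatrix ℂ * X * σ⁻¹.permMatrix ℂ = _
  rw [Equiv.Perm.permMatrix, Equiv.Perm.permMatrix, PEquiv.toMatrix_toPEquiv_mul,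
    PEquiv.mul_toMatrix_toPEquiv, Matrix.submatrix_submatrix]
  rfl

theorem normalResidue_eq (m : Fin r → ℤ) (a : Fin r → ℝ) (σ : Equiv.Perm (Fin r)) :
    normalResidue m a σ = Matrix.diagonal fun j => (m j : ℂ) + a (σ j) := by
  rw [normalResidue, Ad_add, ← Ad_mul, mul_inv_cancel, Ad_one, Ad_permGL, weightMat, splitMat,
    Matrix.submatrix_diagonal_equiv, Matrix.diagonal_add]
  simp only [Function.comp, add_comm]

/-- Nonresonance, on which both existence and uniqueness rest: two numbers in `[0, 1)` differ by
less than 1, hence by an integer only if they are equal. -/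
theorem int_add_sub_ne_zero {a b : ℝ} (ha : 0 ≤ a ∧ a < 1) (hb : 0 ≤ b ∧ b < 1) (hab : a ≠ b)
    (n : ℤ) : (n : ℂ) + a - b ≠ 0 := by
  intro h
  have h' : (n : ℝ) + a - b = 0 := by exact_mod_cast h
  have h1 : n < 1 := by exact_mod_cast (by linarith [ha.1, hb.2] : (n : ℝ) < 1)
  have h2 : -1 < n := by exact_mod_cast (by linarith [ha.2, hb.1] : (-1 : ℝ) < n)
  have h3 : n = 0 := by omega
  subst h3
  exact hab (by push_cast at h'; linarith)

/-! ### Flags -/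

theorem CompleteFlag.act_flagOfFrame (g B : GL (Fin r) ℂ) :
    (flagOfFrame B).act g = flagOfFrame (g * B) := by
  ext1
  funext j
  simp only [CompleteFlag.act, flagOfFrame, Submodule.map_span, Set.image_image]
  congr 1

/-! ### The gauge action on logarithmic connections -/

theorem isEntire_Ad {m : Fin r → ℤ} (g : BundleAut m) {f : ℂ → Mat r} (hf : IsEntire f) :
    IsEntire fun w => Ad (g.g0 w) (f w) :=
  (IsEntire.mul g.holo0 hf).mul (IsEntire.inv g.holo0)

/-- Replacing `g0 w` by `g0 (z i)` in the conjugate of the residue costs an entire divided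
difference. -/
theorem BundleAut.act_pole_expansion {m : Fin r → ℤ} (g : BundleAut m) {z : Fin k → ℂ}
    {A : ℂ → Mat r} {R : Fin k → Mat r} {f₀ : ℂ → Mat r} (hf₀ : IsEntire f₀)
    (hA : ∀ w, w ∉ Set.range z → A w = ∑ i, (w - z i)⁻¹ • R i + f₀ w) :
    ∃ f : ℂ → Mat r, IsEntire f ∧ ∀ w, w ∉ Set.range z →
      g.act A w = ∑ i, (w - z i)⁻¹ • Ad (g.g0 (z i)) (R i) + f w := by
  choose h hh he using fun i => (isEntire_Ad g (isEntire_const (R i))).exists_smul_eq (z i)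
  refine ⟨fun w => (∑ i, h i w) + (Ad (g.g0 w) (f₀ w) -
    matDeriv (fun u => (g.g0 u : Mat r)) w * (((g.g0 w)⁻¹ : GL (Fin r) ℂ) : Mat r)), ?_, ?_⟩
  · exact (IsEntire.sum _ hh).add ((isEntire_Ad g hf₀).sub
      ((isEntire_matDeriv g.holo0).mul (IsEntire.inv g.holo0)))
  · intro w hw
    have hs : ∀ i, (w - z i)⁻¹ • Ad (g.g0 w) (R i) =
        (w - z i)⁻¹ • Ad (g.g0 (z i)) (R i) + h i w :=
      fun i => he i w fun hwi => hw ⟨i, hwi.symm⟩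
    rw [BundleAut.act, hA w hw, Ad_add, Ad_sum]
    simp only [Ad_smul, hs, Finset.sum_add_distrib]
    abel

theorem BundleAut.connAtInfty_act_expansion {m : Fin r → ℤ} (g : BundleAut m)
    {A : ℂ → Mat r} {R : Mat r} {f₁ : ℂ → Mat r} (hf₁ : IsHolomorphicAtZero f₁)
    (hA : ∀ᶠ ζ in 𝓝[≠] (0 : ℂ), connAtInfty m A ζ = ζ⁻¹ • R + f₁ ζ) :
    ∃ f : ℂ → Mat r, IsHolomorphicAtZero f ∧ ∀ᶠ ζ in 𝓝[≠] (0 : ℂ),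
      connAtInfty m (g.act A) ζ = ζ⁻¹ • Ad (g.g1 0) R + f ζ := by
  have h1 : IsHolomorphicAtZero fun ζ => (g.g1 ζ : Mat r) := g.holo1.isHolomorphicAtZero
  have h2 : IsHolomorphicAtZero fun ζ => (((g.g1 ζ)⁻¹ : GL (Fin r) ℂ) : Mat r) :=
    (IsEntire.inv g.holo1).isHolomorphicAtZero
  have hAd : ∀ {f : ℂ → Mat r}, IsHolomorphicAtZero f →
      IsHolomorphicAtZero fun ζ => Ad (g.g1 ζ) (f ζ) := fun hf => (h1.mul hf).mul h2
  obtain ⟨h, hh, he⟩ := (hAd (isHolomorphicAtZero_const R)).exists_smul_eq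
  refine ⟨fun ζ => h ζ + (Ad (g.g1 ζ) (f₁ ζ) -
    matDeriv (fun u => (g.g1 u : Mat r)) ζ * (((g.g1 ζ)⁻¹ : GL (Fin r) ℂ) : Mat r)), ?_, ?_⟩
  · exact hh.add ((hAd hf₁).sub ((isEntire_matDeriv g.holo1).isHolomorphicAtZero.mul h2))
  · filter_upwards [hA, self_mem_nhdsWithin] with ζ hζ hζ0
    rw [g.connAtInfty_act A hζ0, hζ, Ad_add, Ad_smul, he ζ hζ0]
    abel

theorem BundleAut.isAdaptedConnection_act {m : Fin r → ℤ} (g : BundleAut m) {z : Fin k → ℂ}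
    {α : Fin (k + 1) → Fin r → ℝ} {F : Fin (k + 1) → CompleteFlag r} {A : ℂ → Mat r}
    (hA : IsAdaptedConnection m z α F A) :
    IsAdaptedConnection m z α (g.actFlags z F) (g.act A) := by
  obtain ⟨R, ⟨f₀, hf₀, h0⟩, ⟨f₁, hf₁, h1⟩, hB⟩ := hA
  refine ⟨Fin.lastCases (motive := fun _ => Mat r) (Ad (g.g1 0) (R (Fin.last k)))
    (fun i => Ad (g.g0 (z i)) (R i.castSucc)), ?_, ?_, ?_⟩
  · simpa only [Fin.lastCases_castSucc] using g.act_pole_expansion hf₀ h0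
  · simpa only [Fin.lastCases_last] using g.connAtInfty_act_expansion hf₁ h1
  · intro i
    obtain ⟨B, hR, hF⟩ := hB i
    induction i using Fin.lastCases with
    | last =>
      refine ⟨g.g1 0 * B, ?_, ?_⟩
      · rw [Fin.lastCases_last, hR, Ad_mul]
      · rw [BundleAut.actFlags, Fin.lastCases_last, hF, CompleteFlag.act_flagOfFrame]
    | cast i =>
      refine ⟨g.g0 (z i) * B, ?_, ?_⟩
      · rw [Fin.lastCases_castSucc, hR, Ad_mul]
      · rw [BundleAut.actFlags, Fin.lastCases_castSucc, hF, CompleteFlag.act_flagOfFrame]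

/-! ### Fuchsian systems -/

/-- Solving the expansion at infinity for `f₀ ζ⁻¹` shows that it tends to zero with `ζ`, so `f₀`
vanishes by Liouville's theorem. -/
theorem isFuchsianSystem_of_formAtInfty {z : Fin k → ℂ} {A : ℂ → Mat r} {R : Fin k → Mat r}
    {f₀ : ℂ → Mat r} (hf₀ : IsEntire f₀)
    (hA : ∀ w, w ∉ Set.range z → A w = ∑ i, (w - z i)⁻¹ • R i + f₀ w) {D : Mat r}
    {f : ℂ → Mat r} (hf : IsHolomorphicAtZero f)
    (hD : ∀ᶠ ζ in 𝓝[≠] (0 : ℂ), formAtInfty A ζ = ζ⁻¹ • D + f ζ) :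
    IsFuchsianSystem z A R ∧ ∑ i, R i = -D := by
  have hz : ∀ᶠ ζ in 𝓝[≠] (0 : ℂ), ∀ i, 1 - ζ * z i ≠ 0 := by
    refine eventually_nhdsWithin_of_eventually_nhds (eventually_all.2 fun i => ?_)
    have : ContinuousAt (fun ζ : ℂ => 1 - ζ * z i) 0 := by fun_prop
    exact this.eventually_ne (by simp)
  have hkey : ∀ᶠ ζ in 𝓝[≠] (0 : ℂ),
      f₀ ζ⁻¹ = -(ζ • D) - ζ ^ 2 • f ζ - ζ • ∑ i, (1 - ζ * z i)⁻¹ • R i := by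
    filter_upwards [hz, hD, self_mem_nhdsWithin] with ζ h1 h2 h3
    have h3 : ζ ≠ 0 := h3
    have hinv : ∀ i, (ζ⁻¹ - z i)⁻¹ = ζ * (1 - ζ * z i)⁻¹ := fun i => by
      have : ζ⁻¹ - z i = (1 - ζ * z i) * ζ⁻¹ := by field_simp
      rw [this, mul_inv, inv_inv, mul_comm]
    have hmem : ζ⁻¹ ∉ Set.range z := by
      rintro ⟨i, hi⟩
      exact h1 i (by rw [hi, mul_inv_cancel₀ h3, sub_self])
    rw [formAtInfty, hA _ hmem] at h2
    have h4 : ∑ i, (ζ⁻¹ - z i)⁻¹ • R i + f₀ ζ⁻¹ = -(ζ ^ 2) • (ζ⁻¹ • D + f ζ) := by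
      rw [← h2, smul_smul]
      have : -ζ ^ 2 * -(ζ ^ 2)⁻¹ = 1 := by field_simp
      rw [this, one_smul]
    rw [← eq_sub_iff_add_eq'] at h4
    rw [h4]
    simp only [hinv, mul_smul, ← Finset.smul_sum]
    rw [smul_add, smul_smul]
    have : -ζ ^ 2 * ζ⁻¹ = -ζ := by field_simp
    rw [this, neg_smul, neg_smul]
    abel
  have hid : Tendsto (fun ζ : ℂ => ζ) (𝓝[≠] 0) (𝓝 0) := tendsto_id.mono_left nhdsWithin_le_nhds
  have hft : Tendsto f (𝓝[≠] 0) (𝓝 (f 0)) := hf.continuousAt.mono_left nhdsWithin_le_nhds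
  have hst : Tendsto (fun ζ : ℂ => ∑ i, (1 - ζ * z i)⁻¹ • R i) (𝓝[≠] 0) (𝓝 (∑ i, R i)) := by
    refine tendsto_finsetSum _ fun i _ => ?_
    have h1 : Tendsto (fun ζ : ℂ => (1 - ζ * z i)⁻¹) (𝓝[≠] 0) (𝓝 1) := by
      have : ContinuousAt (fun ζ : ℂ => (1 - ζ * z i)⁻¹) 0 := by fun_prop (disch := simp)
      simpa using this.tendsto.mono_left nhdsWithin_le_nhds
    simpa using h1.smul_const (R i)
  have hf₀z : ∀ w, f₀ w = 0 := by
    refine hf₀.eq_const_of_tendsto_inv ?_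
    refine Tendsto.congr' (EventuallyEq.symm hkey) ?_
    simpa using (((hid.smul_const D).neg.sub ((hid.pow 2).smul hft)).sub (hid.smul hst))
  refine ⟨fun w hw => by rw [hA w hw, hf₀z, add_zero], ?_⟩
  -- With `f₀ = 0` the identity can be divided by `ζ`; its limit at `0` is the residue relation.
  have hkey2 : ∀ᶠ ζ in 𝓝[≠] (0 : ℂ), -D - ζ • f ζ = ∑ i, (1 - ζ * z i)⁻¹ • R i := by
    filter_upwards [hkey, self_mem_nhdsWithin] with ζ h1 h2
    have h2 : ζ ≠ 0 := h2
    rw [hf₀z] at h1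
    have h3 : ζ • (-D - ζ • f ζ) = ζ • ∑ i, (1 - ζ * z i)⁻¹ • R i := by
      rw [← sub_eq_zero, h1, smul_sub, smul_smul, smul_neg, pow_two]
    exact smul_right_injective _ h2 h3
  refine tendsto_nhds_unique (hst.congr' (EventuallyEq.symm hkey2)) ?_
  simpa using tendsto_const_nhds.sub (hid.smul hft)

/-! ### Uniqueness of the normalizing gauge -/

section Uniqueness

variable {m : Fin r → ℤ} {a : Fin r → ℝ} {σ : Equiv.Perm (Fin r)}

theorem BundleAut.hasDerivAt_g0_inv (h : BundleAut m) {ζ : ℂ} (hζ : ζ ≠ 0) (i j : Fin r) :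
    HasDerivAt (fun u : ℂ => (h.g0 u⁻¹ : Mat r) i j)
      ((-(ζ ^ 2)⁻¹ • matDeriv (fun u => (h.g0 u : Mat r)) ζ⁻¹) i j) ζ := by
  have := HasDerivAt.comp (h₂ := fun u => (h.g0 u : Mat r) i j) ζ (h.holo0.hasDerivAt ζ⁻¹ i j)
    (hasDerivAt_inv hζ)
  rw [Matrix.smul_apply, smul_eq_mul, mul_comm]
  exact this

theorem BundleAut.smul_deriv_g0_inv (h : BundleAut m) {A : ℂ → Mat r} {ζ : ℂ} :
    -(ζ ^ 2)⁻¹ • matDeriv (fun u => (h.g0 u : Mat r)) ζ⁻¹ =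
      (h.g0 ζ⁻¹ : Mat r) * formAtInfty A ζ - formAtInfty (h.act A) ζ * h.g0 ζ⁻¹ := by
  have := h.act_mul_g0 A ζ⁻¹
  rw [formAtInfty, formAtInfty, mul_smul_comm, smul_mul_assoc, ← smul_sub, this, sub_sub_cancel]

/-- An automorphism between two normalized forms is, to leading order at infinity, an
eigenvector of the adjoint action of the normalized residue. -/
theorem BundleAut.leading_term (h : BundleAut m) {A : ℂ → Mat r}
    {D : Fin r → ℂ} {f f' : ℂ → Mat r} (hf : IsHolomorphicAtZero f) (hf' : IsHolomorphicAtZero f')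
    (hA : ∀ᶠ ζ in 𝓝[≠] (0 : ℂ), formAtInfty A ζ = ζ⁻¹ • Matrix.diagonal D + f ζ)
    (hA' : ∀ᶠ ζ in 𝓝[≠] (0 : ℂ), formAtInfty (h.act A) ζ = ζ⁻¹ • Matrix.diagonal D + f' ζ)
    (n : ℕ) {G : ℂ → Mat r} (hG : IsHolomorphicAtZero G)
    (hH : ∀ᶠ ζ in 𝓝[≠] (0 : ℂ), ζ ^ n • (h.g0 ζ⁻¹ : Mat r) = G ζ) (i j : Fin r) :
    ((n : ℂ) + D j - D i) * G 0 i j = 0 := by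
  -- With `H ζ = g0 ζ⁻¹`, the gauge relation reads `H' = H a - a' H` for the two forms `a`, `a'` at
  -- infinity. Multiplied by `ζ ^ (n + 1)`, it becomes an equation for `G` that is regular at `0`;
  -- there the left side vanishes and the right side is `n G + G D - D G`.
  have hderiv : ∀ᶠ ζ in 𝓝[≠] (0 : ℂ), ζ * deriv (fun u => G u i j) ζ =
      ((n : ℂ) • G ζ + G ζ * (Matrix.diagonal D + ζ • f ζ) -
        (Matrix.diagonal D + ζ • f' ζ) * G ζ) i j := by
    have hH' : ∀ᶠ ζ in 𝓝[≠] (0 : ℂ), ∀ᶠ u in 𝓝 ζ, u ^ n • (h.g0 u⁻¹ : Mat r) = G u :=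
      (eventually_eventually_nhdsWithin.2 hH).mp <| by
        filter_upwards [self_mem_nhdsWithin] with ζ hζ hev
        rwa [IsOpen.nhdsWithin_eq isOpen_compl_singleton hζ] at hev
    filter_upwards [hH', hA, hA', self_mem_nhdsWithin] with ζ h1 h2 h3 h4
    have h4 : ζ ≠ 0 := h4
    have hd := (hasDerivAt_pow n ζ).mul (h.hasDerivAt_g0_inv h4 i j)
    have he : (fun u => G u i j) =ᶠ[𝓝 ζ] fun u => u ^ n * (h.g0 u⁻¹ : Mat r) i j := by
      filter_upwards [h1] with u hu
      rw [← hu]; rfl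
    rw [he.deriv_eq]
    have e2 : ζ • formAtInfty A ζ = Matrix.diagonal D + ζ • f ζ := by
      rw [h2, smul_add, smul_smul, mul_inv_cancel₀ h4, one_smul]
    have e3 : ζ • formAtInfty (h.act A) ζ = Matrix.diagonal D + ζ • f' ζ := by
      rw [h3, smul_add, smul_smul, mul_inv_cancel₀ h4, one_smul]
    rw [show deriv (fun u => u ^ n * (h.g0 u⁻¹ : Mat r) i j) ζ = _ from hd.deriv,
      h.smul_deriv_g0_inv (A := A), ← e2, ← e3, ← h1.self_of_nhds]
    have hn : ζ * ((n : ℂ) * ζ ^ (n - 1)) = n * ζ ^ n := by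
      rcases n with _ | n
      · simp
      · rw [Nat.add_sub_cancel, pow_succ]; ring
    simp only [smul_mul_assoc, mul_smul_comm, Matrix.add_apply, Matrix.sub_apply,
      Matrix.smul_apply, smul_eq_mul]
    linear_combination (h.g0 ζ⁻¹ : Mat r) i j * hn
  have hc1 : ContinuousAt (fun ζ => ζ * deriv (fun u => G u i j) ζ) 0 :=
    continuousAt_id.mul (hG i j).deriv.continuousAt
  have hc2 : IsHolomorphicAtZero fun ζ => G ζ * (Matrix.diagonal D + ζ • f ζ) -
      (Matrix.diagonal D + ζ • f' ζ) * G ζ :=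
    (hG.mul ((isHolomorphicAtZero_const _).add hf.smul)).sub
      (((isHolomorphicAtZero_const _).add hf'.smul).mul hG)
  have hc3 : ContinuousAt (fun ζ => ((n : ℂ) • G ζ + G ζ * (Matrix.diagonal D + ζ • f ζ) -
        (Matrix.diagonal D + ζ • f' ζ) * G ζ) i j) 0 := by
    have := (((hG i j).continuousAt.const_smul (n : ℂ)).add (hc2 i j).continuousAt)
    refine this.congr (Eventually.of_forall fun ζ => ?_)
    simp only [Matrix.add_apply, Matrix.sub_apply, Matrix.smul_apply, Pi.add_apply, Pi.smul_apply,
      smul_eq_mul]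
    ring
  have := tendsto_nhds_unique
    ((hc1.mono_left (nhdsWithin_le_nhds (s := {0}ᶜ))).congr' hderiv)
    (hc3.mono_left nhdsWithin_le_nhds)
  simp only [zero_mul, zero_smul, add_zero, Matrix.sub_apply, Matrix.add_apply, Matrix.smul_apply,
    Matrix.mul_diagonal, Matrix.diagonal_mul, smul_eq_mul] at this
  linear_combination -this

theorem BundleAut.exists_pole_bound (h : BundleAut m) : ∃ (n : ℕ) (G : ℂ → Mat r),
    IsHolomorphicAtZero G ∧ ∀ᶠ ζ in 𝓝[≠] (0 : ℂ), ζ ^ n • (h.g0 ζ⁻¹ : Mat r) = G ζ := by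
  -- The entries of `g0 ζ⁻¹` are `ζ ^ (m j - m i)` times holomorphic functions; this sum is a crude
  -- bound for every pole order.
  set n := ∑ i, ∑ j, (m j - m i).natAbs with hn
  have hle : ∀ i j, 0 ≤ (n : ℤ) + (m j - m i) := by
    intro i j
    have h1 : (m j - m i).natAbs ≤ ∑ j, (m j - m i).natAbs :=
      Finset.single_le_sum (f := fun j => (m j - m i).natAbs) (fun _ _ => Nat.zero_le _)
        (Finset.mem_univ j)
    have h2 : ∑ j, (m j - m i).natAbs ≤ n :=
      Finset.single_le_sum (f := fun i => ∑ j, (m j - m i).natAbs) (fun _ _ => Nat.zero_le _)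
        (Finset.mem_univ i)
    omega
  refine ⟨n, fun ζ => Matrix.of fun i j =>
    ζ ^ ((n : ℤ) + (m j - m i)).toNat * (h.g1 ζ : Mat r) i j, fun i j => ?_, ?_⟩
  · exact (analyticAt_id.pow _).mul ((h.holo1.isHolomorphicAtZero) i j)
  · filter_upwards [self_mem_nhdsWithin] with ζ hζ
    have hζ : ζ ≠ 0 := hζ
    ext i j
    rw [Matrix.smul_apply, h.g0_inv_eq hζ, powMat_neg_conj_apply m hζ, Matrix.of_apply,
      smul_eq_mul, ← mul_assoc, ← zpow_natCast, ← zpow_natCast, ← zpow_add₀ hζ,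
      Int.toNat_of_nonneg (hle i j)]

theorem BundleAut.eq_diagonal_of_normalized (h : BundleAut m) {A : ℂ → Mat r}
    (ha : Function.Injective a) (ha01 : ∀ j, 0 ≤ a j ∧ a j < 1)
    (hA : IsNormalizedAtInfty m a σ A) (hA' : IsNormalizedAtInfty m a σ (h.act A)) :
    ∃ d : Fin r → ℂ, (∀ j, d j ≠ 0) ∧ ∀ w, (h.g0 w : Mat r) = Matrix.diagonal d := by
  obtain ⟨f, hf, hfA⟩ := hA
  obtain ⟨f', hf', hfA'⟩ := hA'
  rw [normalResidue_eq] at hfA hfA'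
  have hlead := fun n {G} hG hH => h.leading_term hf hf' hfA hfA' n (G := G) hG hH
  have hres : ∀ (n : ℕ) i j, n ≠ 0 ∨ i ≠ j →
      (n : ℂ) + ((m j : ℂ) + a (σ j)) - ((m i : ℂ) + a (σ i)) ≠ 0 := by
    intro n i j hij
    by_cases hij' : i = j
    · subst hij'
      simpa using hij
    · have := int_add_sub_ne_zero (ha01 (σ j)) (ha01 (σ i))
        (fun e => hij' (σ.injective (ha e)).symm) (n + m j - m i)
      push_cast at this
      intro e
      exact this (by linear_combination e)
  obtain ⟨n, G, hG, hH⟩ := h.exists_pole_bound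
  -- Descent on the pole order: for `n > 0` no entry is resonant, the leading coefficient vanishes,
  -- and a factor `ζ` can be removed.
  have hbdd : ∃ G : ℂ → Mat r, IsHolomorphicAtZero G ∧
      ∀ᶠ ζ in 𝓝[≠] (0 : ℂ), ζ ^ 0 • (h.g0 ζ⁻¹ : Mat r) = G ζ := by
    induction n generalizing G with
    | zero => exact ⟨G, hG, hH⟩
    | succ n ih =>
      have h0 : G 0 = 0 := Matrix.ext fun i j =>
        (mul_eq_zero.1 (hlead (n + 1) hG hH i j)).resolve_left (hres _ i j (Or.inl n.succ_ne_zero))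
      obtain ⟨G', hG', he⟩ := hG.exists_eq_smul h0
      refine ih G' hG' ?_
      filter_upwards [hH, self_mem_nhdsWithin] with ζ h1 h2
      have h2 : ζ ≠ 0 := h2
      refine smul_right_injective _ h2 ?_
      change ζ • ζ ^ n • (h.g0 ζ⁻¹ : Mat r) = ζ • G' ζ
      rw [← he, ← h1, smul_smul, pow_succ']
  obtain ⟨G, hG, hH⟩ := hbdd
  have hconst : ∀ w, (h.g0 w : Mat r) = G 0 := by
    refine h.holo0.eq_const_of_tendsto_inv ?_
    refine (hG.continuousAt.mono_left nhdsWithin_le_nhds).congr' ?_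
    filter_upwards [hH] with ζ hζ
    simpa using hζ.symm
  have hdiag : G 0 = Matrix.diagonal fun j => G 0 j j := by
    ext i j
    by_cases hij : i = j
    · subst hij; simp
    · rw [Matrix.diagonal_apply_ne _ hij]
      exact (mul_eq_zero.1 (hlead 0 hG hH i j)).resolve_left (hres 0 i j (Or.inr hij))
  refine ⟨fun j => G 0 j j, fun j => ?_, fun w => by rw [hconst, ← hdiag]⟩
  have hu := (h.g0 0).isUnit
  rw [hconst, hdiag, Matrix.isUnit_iff_isUnit_det, Matrix.det_diagonal, isUnit_iff_ne_zero,
    Finset.prod_ne_zero_iff] at hu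
  exact hu j (Finset.mem_univ j)

theorem BundleAut.normalizing_unique (g g' : BundleAut m) {A : ℂ → Mat r}
    (ha : Function.Injective a) (ha01 : ∀ j, 0 ≤ a j ∧ a j < 1)
    (hA : IsNormalizedAtInfty m a σ (g.act A)) (hA' : IsNormalizedAtInfty m a σ (g'.act A)) :
    ∃ d : Fin r → ℂ, (∀ j, d j ≠ 0) ∧
      ∀ w, (g'.g0 w : Mat r) = Matrix.diagonal d * (g.g0 w : Mat r) := by
  have he : (g'.mul g.inv).act (g.act A) = g'.act A := by
    rw [← BundleAut.act_mul]
    have h0 : ((g'.mul g.inv).mul g).g0 = g'.g0 := by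
      funext w
      simp [BundleAut.mul, BundleAut.inv]
    funext w
    simp only [BundleAut.act, h0]
  obtain ⟨d, hd, hd'⟩ := (g'.mul g.inv).eq_diagonal_of_normalized ha ha01 hA (he ▸ hA')
  refine ⟨d, hd, fun w => ?_⟩
  rw [← hd' w]
  simp [BundleAut.mul, BundleAut.inv]

end Uniqueness

/-! ### Gauge transformations and monodromy -/

/-- If `Y` continues a solution for `A`, then `g0 Y` does so for `g · A`; the constant factor `g0
x₀` inverse on the right restores the initial value `1`. -/
theorem BundleAut.isMonodromyRep_act {m : Fin r → ℤ} (g : BundleAut m) {z : Fin k → ℂ}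
    {A : ℂ → Mat r} {x₀ : Punctured z} {ρ : FundamentalGroup (Punctured z) x₀ →* GL (Fin r) ℂ}
    (hρ : IsMonodromyRep z A x₀ ρ) :
    IsMonodromyRep z (g.act A) x₀ ((MulAut.conj (g.g0 x₀)).toMonoidHom.comp ρ) := by
  intro γ
  obtain ⟨Y, hY, hY0, hY1⟩ := hρ γ
  set C := (((g.g0 x₀)⁻¹ : GL (Fin r) ℂ) : Mat r) with hC
  refine ⟨fun t => g.g0 (γ t : Punctured z) * Y t * C, fun t => ?_, ?_, ?_⟩
  · obtain ⟨Φ, hΦ, hYΦ⟩ := hY t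
    refine ⟨fun u => g.g0 u * Φ u * C, ?_, ?_⟩
    · filter_upwards [hΦ] with w hw a b
      have h1 := hasDerivAt_matrix_mul (M := fun u => (g.g0 u : Mat r) * Φ u) (N := fun _ => C)
        (N' := 0) (hasDerivAt_matrix_mul (N' := -(A w * Φ w)) (g.holo0.hasDerivAt w) hw)
        (fun a b => hasDerivAt_const _ _) a b
      have h2 := g.act_mul_g0 A w
      have h3 : (matDeriv (fun u => (g.g0 u : Mat r)) w * Φ w + (g.g0 w : Mat r) * -(A w * Φ w)) * C
          + (g.g0 w : Mat r) * Φ w * 0 = -(g.act A w * (g.g0 w * Φ w * C)) := by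
        rw [← Matrix.mul_assoc, ← Matrix.mul_assoc, h2]
        simp only [sub_mul, add_mul, mul_neg, neg_mul, mul_zero, add_zero, Matrix.mul_assoc]
        abel
      rw [h3] at h1
      exact h1
    · filter_upwards [hYΦ] with s hs
      rw [hs]
  · simp only [hY0, γ.source, mul_one, hC]
    exact Units.mul_inv _
  · simp only [hY1, γ.target, hC]
    rfl

/-! ### Relative position of flags -/

/-- Lower triangular matrices. -/
def IsLower (M : Mat r) : Prop := M.BlockTriangular OrderDual.toDual

theorem isLower_iff {M : Mat r} : IsLower M ↔ ∀ i j, i < j → M i j = 0 :=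
  ⟨fun h _ _ hij => h (OrderDual.toDual_lt_toDual.2 hij),
    fun h _ _ hij => h _ _ (OrderDual.toDual_lt_toDual.1 hij)⟩

theorem IsLower.inv {g : GL (Fin r) ℂ} (h : IsLower (g : Mat r)) :
    IsLower ((g⁻¹ : GL (Fin r) ℂ) : Mat r) := by
  rw [Matrix.coe_units_inv]
  let _ : Invertible (g : Mat r) := g.isUnit.invertible
  exact Matrix.blockTriangular_inv_of_blockTriangular h

theorem isParabolic_iff {m : Fin r → ℤ} {p : GL (Fin r) ℂ} :
    IsParabolic m p ↔ (p : Mat r).BlockTriangular fun j => OrderDual.toDual (m j) :=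
  ⟨fun h _ _ hij => h _ _ hij, fun h _ _ hij => h hij⟩

theorem IsParabolic.inv {m : Fin r → ℤ} {p : GL (Fin r) ℂ} (hp : IsParabolic m p) :
    IsParabolic m p⁻¹ := by
  rw [isParabolic_iff] at hp ⊢
  rw [Matrix.coe_units_inv]
  let _ : Invertible (p : Mat r) := p.isUnit.invertible
  exact Matrix.blockTriangular_inv_of_blockTriangular hp

theorem IsLower.isParabolic {m : Fin r → ℤ} (hm : Monotone m) {p : GL (Fin r) ℂ}
    (hp : IsLower (p : Mat r)) : IsParabolic m p := fun i j hij =>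
  isLower_iff.1 hp i j (lt_of_not_ge fun h => hij.not_ge (hm h))

/-- Column `l` of `C U` involves only columns `i ≥ l` of `C`; equality follows from the inclusion by
dimension. -/
theorem flagOfFrame_mul_lower (C : GL (Fin r) ℂ) {U : GL (Fin r) ℂ} (hU : IsLower (U : Mat r)) :
    flagOfFrame (C * U) = flagOfFrame C := by
  ext1
  funext j
  refine Submodule.eq_of_le_of_finrank_eq ?_
    (((flagOfFrame (C * U)).finrank_eq j).trans ((flagOfFrame C).finrank_eq j).symm)
  refine Submodule.span_le.2 ?_
  rintro _ ⟨l, hl, rfl⟩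
  have : ((C * U : GL (Fin r) ℂ) : Mat r).col l =
      ∑ i, (U : Mat r) i l • (C : Mat r).col i := by
    ext a
    simp [Matrix.mul_apply, mul_comm]
  change ((C * U : GL (Fin r) ℂ) : Mat r).col l ∈ (flagOfFrame C).V j
  rw [this]
  refine Submodule.sum_mem _ fun i _ => ?_
  by_cases hil : i < l
  · rw [isLower_iff.1 hU i l hil, zero_smul]
    exact Submodule.zero_mem _
  · refine Submodule.smul_mem _ _ (Submodule.subset_span ⟨i, ?_, rfl⟩)
    exact le_trans hl (not_lt.1 hil)

/-- Column `j` of `B` is a combination of columns `i ≥ j` of `C`, and these are annihilated by row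
`l` of the inverse of `C` when `l < j`. -/
theorem isLower_of_flagOfFrame_eq {B C : GL (Fin r) ℂ} (h : flagOfFrame B = flagOfFrame C) :
    IsLower ((C⁻¹ * B : GL (Fin r) ℂ) : Mat r) := by
  refine isLower_iff.2 fun l j hlj => ?_
  have h1 : (B : Mat r).col j ∈ (flagOfFrame C).V j := by
    rw [← h]
    exact Submodule.subset_span ⟨j, Set.self_mem_Ici, rfl⟩
  have h2 : (flagOfFrame C).V j ≤ LinearMap.ker
      ((LinearMap.proj l).comp (Matrix.mulVecLin ((C⁻¹ : GL (Fin r) ℂ) : Mat r))) := by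
    refine Submodule.span_le.2 ?_
    rintro _ ⟨i, hi, rfl⟩
    change (((C⁻¹ : GL (Fin r) ℂ) : Mat r) * (C : Mat r)) l i = 0
    rw [Units.inv_mul, Matrix.one_apply_ne]
    exact (hlj.trans_le hi).ne
  exact h2 h1

/-- An elementary matrix in the general linear group. -/
noncomputable def transGL (i j : Fin r) (h : i ≠ j) (c : ℂ) : GL (Fin r) ℂ where
  val := Matrix.transvection i j c
  inv := Matrix.transvection i j (-c)
  val_inv := by rw [Matrix.transvection_mul_transvection_same _ _ h]; simp
  inv_val := by rw [Matrix.transvection_mul_transvection_same _ _ h]; simp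

theorem isLower_transGL {i j : Fin r} (h : j < i) (c : ℂ) :
    IsLower (transGL i j h.ne' c : Mat r) := by
  refine isLower_iff.2 fun a b hab => ?_
  change (1 + Matrix.single i j c) a b = 0
  rw [Matrix.add_apply, Matrix.one_apply_ne hab.ne, Matrix.single_apply, if_neg, add_zero]
  rintro ⟨rfl, rfl⟩
  exact absurd hab h.not_gt

/-- The position of the last nonzero entry of a vector. -/
noncomputable def lastIndex (v : Fin r → ℂ) : ℕ :=
  (Finset.univ.filter fun l => v l ≠ 0).sup fun l => (l : ℕ)

theorem exists_lastIndex {v : Fin r → ℂ} (hv : v ≠ 0) : ∃ l, v l ≠ 0 ∧ (l : ℕ) = lastIndex v := by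
  obtain ⟨l, hl⟩ := Function.ne_iff.1 hv
  obtain ⟨i, hi, he⟩ := Finset.exists_mem_eq_sup (Finset.univ.filter fun l => v l ≠ 0)
    ⟨l, by simpa using hl⟩ fun l => (l : ℕ)
  exact ⟨i, by simpa using hi, he.symm⟩

theorem eq_zero_of_lastIndex_lt {v : Fin r → ℂ} {l : Fin r} (h : lastIndex v < l) : v l = 0 := by
  by_contra hl
  exact h.not_ge (Finset.le_sup (f := fun l : Fin r => (l : ℕ)) (by simpa using hl))

theorem row_ne_zero (g : GL (Fin r) ℂ) (i : Fin r) : (g : Mat r) i ≠ 0 := by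
  intro h
  have h1 : ((g : Mat r) * ((g⁻¹ : GL (Fin r) ℂ) : Mat r)) i i = 1 := by
    rw [Units.mul_inv, Matrix.one_apply_eq]
  rw [Matrix.mul_apply] at h1
  simp [h] at h1

/-- Every invertible matrix can be brought, by lower triangular row operations, to a matrix whose
rows end at distinct places. -/
theorem exists_lower_injective_lastIndex (B : GL (Fin r) ℂ) :
    ∃ p : GL (Fin r) ℂ, IsLower (p : Mat r) ∧
      Function.Injective fun i => lastIndex (((p * B : GL (Fin r) ℂ) : Mat r) i) := by
  -- The total of the end positions is minimized. If two rows ended at the same place, subtracting a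
  -- multiple of the upper from the lower, a lower triangular operation, would shorten the lower
  -- one.
  set μ : GL (Fin r) ℂ → ℕ := fun p => ∑ i, lastIndex (((p * B : GL (Fin r) ℂ) : Mat r) i)
  obtain ⟨p, hp, hmin⟩ := WellFounded.has_min (InvImage.wf μ wellFounded_lt) {p | IsLower (p : Mat r)}
    ⟨1, isLower_iff.2 fun i j hij => by simp [Matrix.one_apply_ne hij.ne]⟩
  refine ⟨p, hp, fun i i' hii => ?_⟩
  by_contra hne
  wlog hlt : i < i' generalizing i i'
  · exact this _ _ hii.symm (Ne.symm hne) (lt_of_le_of_ne (not_lt.1 hlt) (Ne.symm hne))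
  set M : Mat r := ((p * B : GL (Fin r) ℂ) : Mat r) with hM
  obtain ⟨l, hl, hle⟩ := exists_lastIndex (row_ne_zero (p * B) i)
  set t := -(M i' l / M i l) with ht
  set q := transGL i' i hlt.ne' t with hq
  have hqM : ((q * p * B : GL (Fin r) ℂ) : Mat r) = Matrix.transvection i' i t * M := by
    rw [mul_assoc, Units.val_mul]; rfl
  refine hmin (q * p) ((isLower_transGL hlt t).mul hp) ?_
  change ∑ i, _ < ∑ i, _
  have hoff : ∀ a, a ≠ i' → ((q * p * B : GL (Fin r) ℂ) : Mat r) a = M a := fun a ha => by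
    funext b
    rw [hqM, Matrix.transvection_mul_apply_of_ne _ _ _ _ ha]
  have hlow : lastIndex (((q * p * B : GL (Fin r) ℂ) : Mat r) i') < lastIndex (M i') := by
    obtain ⟨s, hs, hse⟩ := exists_lastIndex (row_ne_zero (q * p * B) i')
    rw [← hse]
    by_contra hcon
    refine hs ?_
    rw [hqM, Matrix.transvection_mul_apply_same]
    have hii' : lastIndex (M i) = lastIndex (M i') := hii
    have hle' : (l : ℕ) = lastIndex (M i) := hle
    by_cases hsl : s = l
    · rw [hsl, ht]
      have : M i l ≠ 0 := hl
      field_simp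
      ring
    · have h1 : lastIndex (M i') < s :=
        lt_of_le_of_ne (not_lt.1 hcon) fun e => hsl (Fin.ext (by omega))
      have z1 : M i' s = 0 := eq_zero_of_lastIndex_lt h1
      have z2 : M i s = 0 := eq_zero_of_lastIndex_lt (hii'.trans_lt h1)
      rw [z1, z2]
      simp
  refine Finset.sum_lt_sum (fun a _ => ?_) ⟨i', Finset.mem_univ _, hlow⟩
  by_cases ha : a = i'
  · rw [ha]; exact hlow.le
  · rw [hoff a ha]

/-- The relative position of a flag and the standard one is a permutation. -/
theorem exists_inCell {m : Fin r → ℤ} (hm : Monotone m) (B : GL (Fin r) ℂ) :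
    ∃ σ : Equiv.Perm (Fin r), InCell m σ (flagOfFrame B) := by
  obtain ⟨p, hp, hinj⟩ := exists_lower_injective_lastIndex B
  have hex : ∀ i, ∃ l : Fin r, (l : ℕ) = lastIndex (((p * B : GL (Fin r) ℂ) : Mat r) i) :=
    fun i => (exists_lastIndex (row_ne_zero (p * B) i)).imp fun _ h => h.2
  choose c hc using hex
  have hcinj : Function.Injective c := fun i j hij => hinj (by
    change lastIndex (((p * B : GL (Fin r) ℂ) : Mat r) i) =
      lastIndex (((p * B : GL (Fin r) ℂ) : Mat r) j)
    rw [← hc, ← hc, hij])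
  set σ : Equiv.Perm (Fin r) := Equiv.ofBijective c (Finite.injective_iff_bijective.1 hcinj)
  refine ⟨σ, p⁻¹, (hp.inv).isParabolic hm, ?_⟩
  -- Row `a` of the permuted matrix is the row of `p * B` that ends at place `a`, so nothing lies to
  -- the right of the diagonal.
  have hL : IsLower (((permGL σ)⁻¹ * (p * B) : GL (Fin r) ℂ) : Mat r) := by
    refine isLower_iff.2 fun a l hal => ?_
    have : (((permGL σ)⁻¹ * (p * B) : GL (Fin r) ℂ) : Mat r) =
        ((p * B : GL (Fin r) ℂ) : Mat r).submatrix σ.symm id := by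
      rw [Units.val_mul]
      change σ⁻¹.permMatrix ℂ * _ = _
      rw [Equiv.Perm.permMatrix, PEquiv.toMatrix_toPEquiv_mul]
      rfl
    rw [this, Matrix.submatrix_apply]
    refine eq_zero_of_lastIndex_lt ?_
    rw [← hc]
    have : c (σ.symm a) = a := σ.apply_symm_apply a
    rw [this]
    exact hal
  have hB : B = p⁻¹ * permGL σ * ((permGL σ)⁻¹ * (p * B)) := by group
  conv_lhs => rw [hB]
  exact flagOfFrame_mul_lower _ hL

/-! ### Taylor coefficients -/

/-- The Taylor coefficients at `0`. -/
noncomputable def taylorCoeff (f : ℂ → ℂ) : ℕ → ℂ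
  | 0 => f 0
  | n + 1 => taylorCoeff (dslope f 0) n

theorem analyticAt_dslope {f : ℂ → ℂ} (hf : AnalyticAt ℂ f 0) : AnalyticAt ℂ (dslope f 0) 0 := by
  obtain ⟨p, hp⟩ := hf
  exact ⟨_, hp.has_fpower_series_dslope_fslope⟩

theorem taylorCoeff_add {f g : ℂ → ℂ} (hf : AnalyticAt ℂ f 0) (hg : AnalyticAt ℂ g 0) (n : ℕ) :
    taylorCoeff (fun w => f w + g w) n = taylorCoeff f n + taylorCoeff g n := by
  induction n generalizing f g with
  | zero => rfl
  | succ n ih =>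
    have : dslope (fun w => f w + g w) 0 = fun w => dslope f 0 w + dslope g 0 w := by
      funext w
      by_cases hw : w = 0
      · subst hw
        simp only [dslope_same]
        exact deriv_add hf.differentiableAt hg.differentiableAt
      · simp only [dslope_of_ne _ hw, slope, vsub_eq_sub, smul_eq_mul]
        ring
    rw [taylorCoeff, this, ih (analyticAt_dslope hf) (analyticAt_dslope hg)]
    rfl

theorem taylorCoeff_const_mul (c : ℂ) (f : ℂ → ℂ) (n : ℕ) :
    taylorCoeff (fun w => c * f w) n = c * taylorCoeff f n := by
  induction n generalizing f with
  | zero => rfl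
  | succ n ih =>
    have : dslope (fun w => c * f w) 0 = fun w => c * dslope f 0 w := by
      funext w
      by_cases hw : w = 0
      · subst hw
        simp only [dslope_same]
        exact deriv_const_mul_field c
      · simp only [dslope_of_ne _ hw, slope, vsub_eq_sub, smul_eq_mul]
        ring
    rw [taylorCoeff, this, ih]
    rfl

theorem taylorCoeff_const (c : ℂ) (n : ℕ) :
    taylorCoeff (fun _ => c) n = if n = 0 then c else 0 := by
  have hz : ∀ n, taylorCoeff (fun _ => 0) n = 0 := fun n => by
    simpa using taylorCoeff_const_mul 0 (fun _ => 0) n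
  rcases n with _ | n
  · rfl
  · have : dslope (fun _ : ℂ => c) 0 = fun _ => 0 := by
      funext w
      by_cases hw : w = 0
      · subst hw
        simp
      · simp [dslope_of_ne _ hw, slope]
    rw [taylorCoeff, this, hz, if_neg n.succ_ne_zero]

theorem dslope_id_mul {f : ℂ → ℂ} (hf : AnalyticAt ℂ f 0) :
    dslope (fun w => w * f w) 0 = f := by
  funext w
  by_cases hw : w = 0
  · subst hw
    rw [dslope_same]
    have := (hasDerivAt_id (0 : ℂ)).mul hf.differentiableAt.hasDerivAt
    exact this.deriv.trans (by simp)
  · simp [dslope_of_ne _ hw, slope, hw]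

theorem taylorCoeff_pow_mul {f : ℂ → ℂ} (hf : AnalyticAt ℂ f 0) (e n : ℕ) :
    taylorCoeff (fun w => w ^ e * f w) n = if e ≤ n then taylorCoeff f (n - e) else 0 := by
  induction e generalizing n with
  | zero => simp
  | succ e ih =>
    have h1 : (fun w => w ^ (e + 1) * f w) = fun w => w * (w ^ e * f w) := by
      funext w; ring
    rw [h1]
    rcases n with _ | n
    · simp [taylorCoeff]
    · rw [taylorCoeff, dslope_id_mul (f := fun w => w ^ e * f w) ((analyticAt_id.pow e).mul hf), ih]
      simp

theorem exists_eq_pow_mul {f : ℂ → ℂ} (hf : AnalyticAt ℂ f 0) {n : ℕ}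
    (h : ∀ i < n, taylorCoeff f i = 0) :
    ∃ g : ℂ → ℂ, AnalyticAt ℂ g 0 ∧ ∀ w, f w = w ^ n * g w := by
  induction n generalizing f with
  | zero => exact ⟨f, hf, fun w => by simp⟩
  | succ n ih =>
    obtain ⟨g, hg, he⟩ := ih (analyticAt_dslope hf) fun i hi => h (i + 1) (by omega)
    refine ⟨g, hg, fun w => ?_⟩
    have h0 : f 0 = 0 := h 0 n.succ_pos
    have := sub_smul_dslope f 0 w
    rw [sub_zero, h0, sub_zero, smul_eq_mul, he] at this
    rw [← this]; ring

/-! ### Constant and elementary automorphisms -/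

/-- Conjugation by `w ^ N` written with natural exponents. Truncation by `toNat` is harmless, since
it only occurs at entries that vanish, and otherwise the exponents add up. -/
theorem twisted_mul {m : Fin r → ℤ} {p q : Mat r} (hp : ∀ i j, m i < m j → p i j = 0)
    (hq : ∀ i j, m i < m j → q i j = 0) (hpq : p * q = 1) (w : ℂ) :
    (Matrix.of fun i j => p i j * w ^ (m i - m j).toNat : Mat r) *
      (Matrix.of fun i j => q i j * w ^ (m i - m j).toNat) = 1 := by
  ext i j
  have h1 : (p * q) i j = (1 : Mat r) i j := by rw [hpq]
  have h2 : ∀ c, p i c * w ^ (m i - m c).toNat * (q c j * w ^ (m c - m j).toNat) =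
      p i c * q c j * w ^ (m i - m j).toNat := by
    intro c
    by_cases hi : m i < m c
    · simp [hp i c hi]
    by_cases hj : m c < m j
    · simp [hq c j hj]
    have : (m i - m j).toNat = (m i - m c).toNat + (m c - m j).toNat := by omega
    rw [this, pow_add]; ring
  rw [Matrix.mul_apply] at h1 ⊢
  simp only [Matrix.of_apply, h2, ← Finset.sum_mul, h1]
  by_cases hij : i = j
  · subst hij; simp
  · simp [Matrix.one_apply_ne hij]

/-- The automorphism that is constant in the chart at infinity. -/
noncomputable def BundleAut.const {m : Fin r → ℤ} (p : GL (Fin r) ℂ) (hp : IsParabolic m p) :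
    BundleAut m where
  g0 w :=
    { val := Matrix.of fun i j => (p : Mat r) i j * w ^ (m i - m j).toNat
      inv := Matrix.of fun i j => ((p⁻¹ : GL (Fin r) ℂ) : Mat r) i j * w ^ (m i - m j).toNat
      val_inv := twisted_mul hp hp.inv p.mul_inv w
      inv_val := twisted_mul hp.inv hp p.inv_mul w }
  g1 _ := p
  holo0 i j := by
    change Differentiable ℂ fun w => (p : Mat r) i j * w ^ (m i - m j).toNat
    fun_prop
  holo1 := isEntire_const _
  glue w hw := by
    ext i j
    rw [powMat_conj_apply m hw]
    change (p : Mat r) i j * w ^ (m i - m j).toNat = _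
    by_cases hij : m i < m j
    · simp [hp i j hij]
    · rw [mul_comm, ← zpow_natCast, Int.toNat_of_nonneg (by omega)]

/-- The elementary automorphism `1 + c ζ ^ e E i j`, in the chart at infinity. -/
noncomputable def BundleAut.elementary {m : Fin r → ℤ} (i j : Fin r) (hij : i ≠ j) (c : ℂ) (e : ℕ)
    (he : (e : ℤ) ≤ m i - m j) : BundleAut m where
  -- Gluing turns `ζ ^ e` into `w ^ (m i - m j - e)`; `he` is what makes this entire.
  g0 w := transGL i j hij (c * w ^ (m i - m j - e).toNat)
  g1 ζ := transGL i j hij (c * ζ ^ e)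
  holo0 a b := by
    change Differentiable ℂ fun w => (1 + Matrix.single i j (c * w ^ (m i - m j - e).toNat)) a b
    simp only [Matrix.add_apply, Matrix.single_apply]
    split_ifs <;> fun_prop
  holo1 a b := by
    change Differentiable ℂ fun w => (1 + Matrix.single i j (c * w ^ e)) a b
    simp only [Matrix.add_apply, Matrix.single_apply]
    split_ifs <;> fun_prop
  glue w hw := by
    ext a b
    rw [powMat_conj_apply m hw]
    change ((1 : Mat r) + Matrix.single i j (c * w ^ (m i - m j - e).toNat)) a b =
      w ^ (m a - m b) * ((1 : Mat r) + Matrix.single i j (c * w⁻¹ ^ e)) a b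
    simp only [Matrix.add_apply, Matrix.single_apply]
    have h1 : (1 : Mat r) a b = w ^ (m a - m b) * (1 : Mat r) a b := by
      by_cases hab : a = b
      · subst hab; simp
      · simp [Matrix.one_apply_ne hab]
    split_ifs with h
    · obtain ⟨rfl, rfl⟩ := h
      have h2 : w ^ (m i - m j - e).toNat = w ^ (m i - m j) * w⁻¹ ^ e := by
        rw [← zpow_natCast, Int.toNat_of_nonneg (by omega), zpow_sub₀ hw, zpow_natCast, inv_pow,
          div_eq_mul_inv]
      rw [mul_add, ← h1, h2]; ring
    · rw [add_zero, ← h1]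

/-! ### The connection germ at infinity -/

/-- `P(ζ) dζ / ζ` is the germ at infinity of the connection, in the trivialization over the chart
at infinity. -/
def IsGermAtInfty (m : Fin r → ℤ) (A P : ℂ → Mat r) : Prop :=
  IsHolomorphicAtZero P ∧ ∀ᶠ ζ in 𝓝[≠] (0 : ℂ), connAtInfty m A ζ = ζ⁻¹ • P ζ

theorem BundleAut.isGermAtInfty_act {m : Fin r → ℤ} (g : BundleAut m) {A P : ℂ → Mat r}
    (hP : IsGermAtInfty m A P) :
    IsGermAtInfty m (g.act A) fun ζ => Ad (g.g1 ζ) (P ζ) -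
      ζ • (matDeriv (fun u => (g.g1 u : Mat r)) ζ * (((g.g1 ζ)⁻¹ : GL (Fin r) ℂ) : Mat r)) := by
  have h1 : IsHolomorphicAtZero fun ζ => (g.g1 ζ : Mat r) := g.holo1.isHolomorphicAtZero
  have h2 : IsHolomorphicAtZero fun ζ => (((g.g1 ζ)⁻¹ : GL (Fin r) ℂ) : Mat r) :=
    (IsEntire.inv g.holo1).isHolomorphicAtZero
  refine ⟨((h1.mul hP.1).mul h2).sub
    ((isEntire_matDeriv g.holo1).isHolomorphicAtZero.mul h2).smul, ?_⟩
  filter_upwards [hP.2, self_mem_nhdsWithin] with ζ hζ hζ0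
  have hζ0 : ζ ≠ 0 := hζ0
  rw [g.connAtInfty_act A hζ0, hζ, Ad_smul, smul_sub, smul_smul, inv_mul_cancel₀ hζ0, one_smul]

theorem transvection_conj_apply {i j : Fin r} (t : ℂ) (P : Mat r) (a b : Fin r) :
    (Matrix.transvection i j t * P * Matrix.transvection i j (-t)) a b =
      P a b + t * (if a = i then P j b else 0) - t * (if b = j then P a i else 0) -
        t ^ 2 * (if a = i ∧ b = j then P j i else 0) := by
  by_cases ha : a = i <;> by_cases hb : b = j
  · subst ha hb
    simp only [Matrix.mul_transvection_apply_same, Matrix.transvection_mul_apply_same, if_true,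
      and_self]
    ring
  · subst ha
    simp only [Matrix.mul_transvection_apply_of_ne _ _ _ _ hb, Matrix.transvection_mul_apply_same,
      if_true, hb, if_false, and_false]
    ring
  · subst hb
    simp only [Matrix.mul_transvection_apply_same, Matrix.transvection_mul_apply_of_ne _ _ _ _ ha,
      if_true, ha, if_false, false_and]
    ring
  · simp only [Matrix.mul_transvection_apply_of_ne _ _ _ _ hb,
      Matrix.transvection_mul_apply_of_ne _ _ _ _ ha, ha, hb, if_false, false_and]
    ring

theorem smul_matDeriv_elementary {m : Fin r → ℤ} {i j : Fin r} (hij : i ≠ j) (c : ℂ) (e : ℕ)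
    (he : (e : ℤ) ≤ m i - m j) (ζ : ℂ) (a b : Fin r) :
    (ζ • (matDeriv (fun u => ((BundleAut.elementary i j hij c e he).g1 u : Mat r)) ζ *
      ((((BundleAut.elementary i j hij c e he).g1 ζ)⁻¹ : GL (Fin r) ℂ) : Mat r))) a b =
      e * c * (ζ ^ e * if a = i ∧ b = j then 1 else 0) := by
  have h1 : matDeriv (fun u => ((BundleAut.elementary i j hij c e he).g1 u : Mat r)) ζ =
      Matrix.single i j (c * (e * ζ ^ (e - 1))) := by
    refine matDeriv_eq fun a b => ?_
    change HasDerivAt (fun u => (1 + Matrix.single i j (c * u ^ e)) a b) _ ζ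
    simp only [Matrix.add_apply, Matrix.single_apply]
    split_ifs
    · exact ((hasDerivAt_pow e ζ).const_mul c).const_add _
    · exact hasDerivAt_const _ _
  have h2 : ((((BundleAut.elementary i j hij c e he).g1 ζ)⁻¹ : GL (Fin r) ℂ) : Mat r) =
      1 + Matrix.single i j (-(c * ζ ^ e)) := rfl
  have h3 : ζ * (e * ζ ^ (e - 1)) = e * ζ ^ e := by
    rcases e with _ | e
    · simp
    · rw [Nat.add_sub_cancel, pow_succ]; ring
  rw [h1, h2, mul_add, mul_one, Matrix.single_mul_single_of_ne _ _ _ _ hij.symm, add_zero,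
    Matrix.smul_apply, Matrix.single_apply, smul_eq_mul]
  by_cases h : a = i ∧ b = j
  · obtain ⟨rfl, rfl⟩ := h
    simp only [and_self, if_true]
    linear_combination c * h3
  · rw [if_neg h, if_neg fun h' => h ⟨h'.1.symm, h'.2.symm⟩]
    simp

/-- Expansion of `(1 + c ζ ^ e E) P (1 - c ζ ^ e E) - e c ζ ^ e E` with `E = E i j`; the derivative
term is this simple because `E * E = 0`. -/
theorem BundleAut.exists_germ_elementary {m : Fin r → ℤ} {A P : ℂ → Mat r}
    (hP : IsGermAtInfty m A P) {i j : Fin r} (hij : i ≠ j) (c : ℂ) (e : ℕ)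
    (he : (e : ℤ) ≤ m i - m j) :
    ∃ Q, IsGermAtInfty m ((BundleAut.elementary i j hij c e he).act A) Q ∧ ∀ a b n,
      taylorCoeff (fun ζ => Q ζ a b) n = taylorCoeff (fun ζ => P ζ a b) n +
        c * (if a = i ∧ e ≤ n then taylorCoeff (fun ζ => P ζ j b) (n - e) else 0) -
        c * (if b = j ∧ e ≤ n then taylorCoeff (fun ζ => P ζ a i) (n - e) else 0) -
        c ^ 2 * (if (a = i ∧ b = j) ∧ 2 * e ≤ n then
          taylorCoeff (fun ζ => P ζ j i) (n - 2 * e) else 0) -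
        e * c * (if (a = i ∧ b = j) ∧ n = e then 1 else 0) := by
  refine ⟨_, (BundleAut.elementary i j hij c e he).isGermAtInfty_act hP, fun a b n => ?_⟩
  have hzero : ∀ n, taylorCoeff (fun _ => 0) n = 0 := fun n => by
    rw [taylorCoeff_const]; simp
  have hite : ∀ (p : Prop) [Decidable p] (f : ℂ → ℂ) (n : ℕ),
      taylorCoeff (fun ζ => if p then f ζ else 0) n = if p then taylorCoeff f n else 0 := by
    intro p _ f n
    split_ifs
    · rfl
    · exact hzero n
  have haite : ∀ (p : Prop) [Decidable p] (f : ℂ → ℂ), AnalyticAt ℂ f 0 →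
      AnalyticAt ℂ (fun ζ => if p then f ζ else 0) 0 := by
    intro p _ f hf
    split_ifs
    · exact hf
    · exact analyticAt_const
  have hQ : (fun ζ => (Ad ((BundleAut.elementary i j hij c e he).g1 ζ) (P ζ) -
      ζ • (matDeriv (fun u => ((BundleAut.elementary i j hij c e he).g1 u : Mat r)) ζ *
      ((((BundleAut.elementary i j hij c e he).g1 ζ)⁻¹ : GL (Fin r) ℂ) : Mat r))) a b) =
      fun ζ => P ζ a b + (c * (ζ ^ e * if a = i then P ζ j b else 0) +
        (-c * (ζ ^ e * if b = j then P ζ a i else 0) +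
        (-c ^ 2 * (ζ ^ (2 * e) * if a = i ∧ b = j then P ζ j i else 0) +
        -(e * c) * (ζ ^ e * if a = i ∧ b = j then 1 else 0)))) := by
    funext ζ
    rw [Matrix.sub_apply, smul_matDeriv_elementary]
    change (Matrix.transvection i j (c * ζ ^ e) * P ζ * Matrix.transvection i j (-(c * ζ ^ e))) a b
      - _ = _
    rw [transvection_conj_apply]
    ring
  rw [hQ]
  have a1 := haite (a = i) _ (hP.1 j b)
  have a2 := haite (b = j) _ (hP.1 a i)
  have a3 := haite (a = i ∧ b = j) _ (hP.1 j i)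
  have a4 := haite (a = i ∧ b = j) (fun _ => 1) analyticAt_const
  have b1 : AnalyticAt ℂ (fun ζ => c * (ζ ^ e * if a = i then P ζ j b else 0)) 0 :=
    analyticAt_const.mul ((analyticAt_id.pow e).mul a1)
  have b2 : AnalyticAt ℂ (fun ζ => -c * (ζ ^ e * if b = j then P ζ a i else 0)) 0 :=
    analyticAt_const.mul ((analyticAt_id.pow e).mul a2)
  have b3 : AnalyticAt ℂ
      (fun ζ => -c ^ 2 * (ζ ^ (2 * e) * if a = i ∧ b = j then P ζ j i else 0)) 0 :=
    analyticAt_const.mul ((analyticAt_id.pow _).mul a3)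
  have b4 : AnalyticAt ℂ (fun ζ => -(e * c) * (ζ ^ e * if a = i ∧ b = j then 1 else 0)) 0 :=
    analyticAt_const.mul ((analyticAt_id.pow e).mul a4)
  rw [taylorCoeff_add (hP.1 a b) (b1.fun_add (b2.fun_add (b3.fun_add b4))),
    taylorCoeff_add b1 (b2.fun_add (b3.fun_add b4)), taylorCoeff_add b2 (b3.fun_add b4), taylorCoeff_add b3 b4]
  simp only [taylorCoeff_const_mul]
  rw [taylorCoeff_pow_mul a1, taylorCoeff_pow_mul a2, taylorCoeff_pow_mul a3,
    taylorCoeff_pow_mul a4, hite, hite, hite, hite, taylorCoeff_const]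
  have hn : ∀ x : ℂ, (if e ≤ n then if n - e = 0 then x else 0 else 0) = if n = e then x else 0 := by
    intro x
    by_cases h : n = e
    · subst h; simp
    · by_cases h' : e ≤ n
      · rw [if_pos h', if_neg (by omega), if_neg h]
      · rw [if_neg h', if_neg h]
  by_cases ha : a = i <;> by_cases hb : b = j <;>
    simp only [ha, hb, true_and, false_and, and_false, and_self, if_true, if_false, hn, ite_self] <;>
    ring

/-! ### Existence of the normalizing gauge -/

/-- The weight of the monomial `ζ ^ n E i j` in the filtration given by the pole at infinity and
the flag. -/
def weightDeg (σ : Equiv.Perm (Fin r)) (i j : Fin r) (n : ℕ) : ℤ :=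
  (n : ℤ) * r + ((σ i : ℕ) : ℤ) - ((σ j : ℕ) : ℤ)

/-- Additivity is what makes the degree a filtration for matrix multiplication of monomials `ζ ^ n E
i j`. -/
theorem weightDeg_add (σ : Equiv.Perm (Fin r)) (i l j : Fin r) (e n : ℕ) :
    weightDeg σ i j (e + n) = weightDeg σ i l e + weightDeg σ l j n := by
  simp only [weightDeg]; push_cast; ring

theorem weightDeg_injective (σ : Equiv.Perm (Fin r)) {i j : Fin r} {e n : ℕ}
    (h : weightDeg σ i j e = weightDeg σ i j n) : e = n := by
  have hr : (r : ℤ) ≠ 0 := by exact_mod_cast i.pos.ne'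
  have h' : (e : ℤ) * r = n * r := by simp only [weightDeg] at h; linarith
  exact_mod_cast mul_right_cancel₀ hr h'

/-- Positions differ by less than `r`, so a positive power of `ζ`, which counts `r`, always
outweighs them. -/
theorem weightDeg_zero_neg {σ : Equiv.Perm (Fin r)} {i j : Fin r} {n : ℕ}
    (h : weightDeg σ i j n ≤ 0) : n = 0 ∧ σ i ≤ σ j := by
  have h1 := (σ i).isLt
  have h2 := (σ j).isLt
  rcases n with _ | n
  · refine ⟨rfl, ?_⟩
    simp only [weightDeg] at h
    rw [Fin.le_def]
    push_cast at h
    omega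
  · exfalso
    simp only [weightDeg] at h
    push_cast at h
    have : (0 : ℤ) ≤ n * r := by positivity
    nlinarith

/-- The residue of the germ is triangular, up to the permutation, with the weights on the
diagonal. -/
structure IsTriangularGerm (a : Fin r → ℝ) (σ : Equiv.Perm (Fin r)) (P : ℂ → Mat r) : Prop where
  diag : ∀ i, taylorCoeff (fun ζ => P ζ i i) 0 = a (σ i)
  lower : ∀ i j, σ i < σ j → taylorCoeff (fun ζ => P ζ i j) 0 = 0

/-- A triangular germ lives in nonnegative degree, and its part of degree zero is the diagonal of
the residue. -/
theorem IsTriangularGerm.coeff_eq_zero {a : Fin r → ℝ} {σ : Equiv.Perm (Fin r)} {P : ℂ → Mat r}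
    (hP : IsTriangularGerm a σ P) {i j : Fin r} {n : ℕ} (h : weightDeg σ i j n ≤ 0)
    (hne : n = 0 → i ≠ j) : taylorCoeff (fun ζ => P ζ i j) n = 0 := by
  obtain ⟨rfl, hle⟩ := weightDeg_zero_neg h
  exact hP.lower i j (lt_of_le_of_ne hle fun e => hne rfl (σ.injective e))

theorem IsTriangularGerm.coeff_eq_zero_of_neg {a : Fin r → ℝ} {σ : Equiv.Perm (Fin r)}
    {P : ℂ → Mat r} (hP : IsTriangularGerm a σ P) {i j : Fin r} {n : ℕ}
    (h : weightDeg σ i j n < 0) : taylorCoeff (fun ζ => P ζ i j) n = 0 :=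
  hP.coeff_eq_zero h.le fun hn hij => by subst hn hij; simp [weightDeg] at h

/-- The terms of weight less than `δ`, and those of weight `δ` at the entries in `s`, that
obstruct normalization vanish. -/
def IsNormalTo (m : Fin r → ℤ) (σ : Equiv.Perm (Fin r)) (P : ℂ → Mat r) (δ : ℕ)
    (s : Finset (Fin r × Fin r)) : Prop :=
  ∀ (i j : Fin r) (e : ℕ), i ≠ j → (e : ℤ) ≤ m i - m j →
    (weightDeg σ i j e < δ ∨ weightDeg σ i j e = δ ∧ (i, j) ∈ s) →
    taylorCoeff (fun ζ => P ζ i j) e = 0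

/-- The correction terms multiply `ζ ^ e E i j` by terms of `P`, which have degree at least zero. In
degree at most that of `ζ ^ e E i j` only the diagonal of the residue and the derivative contribute,
and only to the chosen coefficient. The value of `t` solves the resulting linear equation. -/
theorem exists_elementary_normalization {m : Fin r → ℤ} {a : Fin r → ℝ}
    {σ : Equiv.Perm (Fin r)} (ha : Function.Injective a) (ha01 : ∀ j, 0 ≤ a j ∧ a j < 1)
    {A P : ℂ → Mat r} (hP : IsGermAtInfty m A P) (hT : IsTriangularGerm a σ P) {i j : Fin r}
    (hij : i ≠ j) {e : ℕ} (he : (e : ℤ) ≤ m i - m j) (hpos : 0 < weightDeg σ i j e) :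
    ∃ (g : BundleAut m) (Q : ℂ → Mat r), IsGermAtInfty m (g.act A) Q ∧
      taylorCoeff (fun ζ => Q ζ i j) e = 0 ∧
      ∀ b c n, weightDeg σ b c n ≤ weightDeg σ i j e → ¬(b = i ∧ c = j ∧ n = e) →
        taylorCoeff (fun ζ => Q ζ b c) n = taylorCoeff (fun ζ => P ζ b c) n := by
  set t : ℂ := taylorCoeff (fun ζ => P ζ i j) e / ((e : ℂ) + a (σ i) - a (σ j)) with ht
  have hden : (e : ℂ) + a (σ i) - a (σ j) ≠ 0 := by
    have := int_add_sub_ne_zero (ha01 (σ i)) (ha01 (σ j))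
      (fun h => hij (σ.injective (ha h))) e
    simpa using this
  obtain ⟨Q, hQ, hc⟩ := BundleAut.exists_germ_elementary hP hij t e he
  refine ⟨_, Q, hQ, ?_, fun b c n hle hne => ?_⟩
  · have h3 : (if (i = i ∧ j = j) ∧ 2 * e ≤ e then
        taylorCoeff (fun ζ => P ζ j i) (e - 2 * e) else 0) = 0 := by
      split_ifs with h
      · have he0 : e = 0 := by omega
        subst he0
        refine hT.coeff_eq_zero_of_neg ?_
        simp only [weightDeg] at hpos ⊢
        push_cast at hpos ⊢
        omega
      · rfl
    rw [hc, h3]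
    simp only [le_refl, and_self, if_true, Nat.sub_self, hT.diag]
    have : t * ((e : ℂ) + a (σ i) - a (σ j)) = taylorCoeff (fun ζ => P ζ i j) e :=
      div_mul_cancel₀ _ hden
    linear_combination -this
  · have h1 : (if b = i ∧ e ≤ n then taylorCoeff (fun ζ => P ζ j c) (n - e) else 0) = 0 := by
      split_ifs with h
      · obtain ⟨rfl, hen⟩ := h
        obtain ⟨n', rfl⟩ := Nat.exists_eq_add_of_le hen
        rw [weightDeg_add σ b j c] at hle
        refine hT.coeff_eq_zero (by rw [Nat.add_sub_cancel_left]; omega) fun hn hjc => ?_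
        exact hne ⟨rfl, hjc.symm, by omega⟩
      · rfl
    have h2 : (if c = j ∧ e ≤ n then taylorCoeff (fun ζ => P ζ b i) (n - e) else 0) = 0 := by
      split_ifs with h
      · obtain ⟨rfl, hen⟩ := h
        obtain ⟨n', rfl⟩ := Nat.exists_eq_add_of_le' hen
        rw [weightDeg_add σ b i c] at hle
        refine hT.coeff_eq_zero (by rw [Nat.add_sub_cancel]; omega) fun hn hbi => ?_
        exact hne ⟨hbi, rfl, by omega⟩
      · rfl
    have h3 : (if (b = i ∧ c = j) ∧ 2 * e ≤ n then
        taylorCoeff (fun ζ => P ζ j i) (n - 2 * e) else 0) = 0 := by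
      split_ifs with h
      · obtain ⟨⟨rfl, rfl⟩, hen⟩ := h
        obtain ⟨n', rfl⟩ := Nat.exists_eq_add_of_le hen
        rw [two_mul, add_assoc, weightDeg_add σ b c c, add_comm e n', weightDeg_add σ c b c] at hle
        refine hT.coeff_eq_zero_of_neg ?_
        rw [Nat.add_sub_cancel_left]
        omega
      · rfl
    have h4 : (if (b = i ∧ c = j) ∧ n = e then (1 : ℂ) else 0) = 0 :=
      if_neg fun h => hne ⟨h.1.1, h.1.2, h.2⟩
    rw [hc, h1, h2, h3, h4]
    ring

/-- Monomials of equal degree do not disturb one another, so the entries are treated one at a time;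
each entry has at most one exponent of degree `δ`. -/
theorem exists_normalization_step {m : Fin r → ℤ} {a : Fin r → ℝ}
    {σ : Equiv.Perm (Fin r)} (ha : Function.Injective a) (ha01 : ∀ j, 0 ≤ a j ∧ a j < 1)
    {A P : ℂ → Mat r} (hP : IsGermAtInfty m A P) (hT : IsTriangularGerm a σ P) {δ : ℕ}
    (hδ : 0 < δ) (s : Finset (Fin r × Fin r)) (hN : IsNormalTo m σ P δ ∅) :
    ∃ (g : BundleAut m) (Q : ℂ → Mat r), IsGermAtInfty m (g.act A) Q ∧
      IsTriangularGerm a σ Q ∧ IsNormalTo m σ Q δ s := by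
  induction s using Finset.induction_on with
  | empty =>
    have h1 : IsParabolic m (1 : GL (Fin r) ℂ) := fun i j hij => by
      have : i ≠ j := fun e => hij.ne (by rw [e])
      simp [Matrix.one_apply_ne this]
    refine ⟨BundleAut.const 1 h1, P, ?_, hT, hN⟩
    have hact := (BundleAut.const 1 h1).isGermAtInfty_act hP
    have hd : ∀ ζ, matDeriv (fun u => ((BundleAut.const 1 h1).g1 u : Mat r)) ζ = 0 :=
      fun ζ => matDeriv_eq fun _ _ => hasDerivAt_const _ _
    simp only [hd, zero_mul, smul_zero, sub_zero] at hact
    refine ⟨hP.1, hact.2.mono fun ζ hζ => hζ.trans ?_⟩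
    exact congrArg _ (Ad_one _)
  | insert p s _ ih =>
    obtain ⟨i, j⟩ := p
    obtain ⟨g, Q, hQ, hQT, hQN⟩ := ih
    by_cases hex : ∃ e : ℕ, i ≠ j ∧ (e : ℤ) ≤ m i - m j ∧ weightDeg σ i j e = δ
    · obtain ⟨e, hij, he, hw⟩ := hex
      obtain ⟨g', Q', hQ', h0, hsame⟩ := exists_elementary_normalization ha ha01 hQ hQT hij he
        (by rw [hw]; exact_mod_cast hδ)
      refine ⟨g'.mul g, Q', by rw [BundleAut.act_mul]; exact hQ', ⟨fun b => ?_, fun b c hbc => ?_⟩,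
        fun b c n hbc hn hor => ?_⟩
      · rw [hsame, hQT.diag]
        · rw [hw]; simp [weightDeg]
        · rintro ⟨rfl, h, -⟩
          exact hij h
      · have hneg : weightDeg σ b c 0 < 0 := by
          rw [Fin.lt_def] at hbc
          simp only [weightDeg]
          push_cast
          omega
        rw [hsame, hQT.lower b c hbc]
        · omega
        · rintro ⟨rfl, rfl, rfl⟩
          omega
      · by_cases heq : b = i ∧ c = j ∧ n = e
        · obtain ⟨rfl, rfl, rfl⟩ := heq
          exact h0
        · rw [hsame b c n (by omega) heq]
          refine hQN b c n hbc hn (hor.imp_right fun h => ⟨h.1, ?_⟩)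
          refine (Finset.mem_insert.1 h.2).resolve_left fun hp => heq ?_
          obtain ⟨rfl, rfl⟩ := Prod.mk.inj hp
          exact ⟨rfl, rfl, weightDeg_injective σ (h.1.trans hw.symm)⟩
    · refine ⟨g, Q, hQ, hQT, fun b c n hbc hn hor => hQN b c n hbc hn (hor.imp_right fun h =>
        ⟨h.1, (Finset.mem_insert.1 h.2).resolve_left fun hp => hex ?_⟩)⟩
      obtain ⟨rfl, rfl⟩ := Prod.mk.inj hp
      exact ⟨n, hbc, hn, h.1⟩

theorem exists_normalization {m : Fin r → ℤ} {a : Fin r → ℝ}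
    {σ : Equiv.Perm (Fin r)} (ha : Function.Injective a) (ha01 : ∀ j, 0 ≤ a j ∧ a j < 1)
    {A P : ℂ → Mat r} (hP : IsGermAtInfty m A P) (hT : IsTriangularGerm a σ P) (δ : ℕ) :
    ∃ (g : BundleAut m) (Q : ℂ → Mat r), IsGermAtInfty m (g.act A) Q ∧
      IsTriangularGerm a σ Q ∧ IsNormalTo m σ Q (δ + 1) ∅ := by
  induction δ with
  | zero =>
    -- Below degree 1 triangularity already kills every off-diagonal term.
    refine exists_normalization_step ha ha01 hP hT Nat.one_pos ∅ fun i j e hij _ hor => ?_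
    refine hT.coeff_eq_zero ?_ fun _ => hij
    simp only [Finset.notMem_empty, and_false, or_false] at hor
    push_cast at hor
    omega
  | succ δ ih =>
    obtain ⟨g, Q, hQ, hQT, hQN⟩ := ih
    obtain ⟨g', Q', hQ', hQT', hQN'⟩ :=
      exists_normalization_step ha ha01 hQ hQT δ.succ_pos Finset.univ hQN
    refine ⟨g'.mul g, Q', by rw [BundleAut.act_mul]; exact hQ', hQT', fun i j e hij he hor => ?_⟩
    refine hQN' i j e hij he ?_
    simp only [Finset.notMem_empty, and_false, or_false, Finset.mem_univ, and_true] at hor ⊢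
    push_cast at hor ⊢
    omega

theorem IsGermAtInfty.isNormalizedAtInfty {m : Fin r → ℤ} {a : Fin r → ℝ}
    {σ : Equiv.Perm (Fin r)} {A P : ℂ → Mat r} (hP : IsGermAtInfty m A P)
    (hT : IsTriangularGerm a σ P)
    (hN : ∀ (i j : Fin r) (e : ℕ), i ≠ j → (e : ℤ) ≤ m i - m j →
      taylorCoeff (fun ζ => P ζ i j) e = 0) :
    IsNormalizedAtInfty m a σ A := by
  have hentry : ∀ i j, ∃ f : ℂ → ℂ, AnalyticAt ℂ f 0 ∧ ∀ ζ, ζ ≠ 0 →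
      ζ ^ (m j - m i) * (ζ⁻¹ * P ζ i j + ζ⁻¹ * splitMat m i j) =
        ζ⁻¹ * normalResidue m a σ i j + f ζ := by
    intro i j
    rw [normalResidue_eq, splitMat]
    by_cases hij : i = j
    · subst hij
      obtain ⟨f, hf, he⟩ := exists_eq_mul_of_zero ((hP.1 i i).sub
        (analyticAt_const (v := P 0 i i))) (sub_self _)
      refine ⟨f, hf, fun ζ hζ => ?_⟩
      have h1 : P ζ i i = a (σ i) + ζ * f ζ := by
        rw [← he, ← hT.diag i]
        simp [taylorCoeff]
      simp only [sub_self, zpow_zero, Matrix.diagonal_apply_eq, h1]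
      field_simp
      ring
    · simp only [Matrix.diagonal_apply_ne _ hij, mul_zero, add_zero, zero_add]
      by_cases hlt : m i < m j
      · refine ⟨fun ζ => ζ ^ (m j - m i - 1).toNat * P ζ i j,
          (analyticAt_id.pow _).mul (hP.1 i j), fun ζ hζ => ?_⟩
        dsimp only
        rw [← zpow_natCast, Int.toNat_of_nonneg (by omega), zpow_sub_one₀ hζ]
        ring
      -- The extra `1` in the order of vanishing cancels the simple pole `ζ⁻¹`.
      · obtain ⟨f, hf, he⟩ := exists_eq_pow_mul (hP.1 i j) (n := (m i - m j).toNat + 1)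
          fun n hn => hN i j n hij (by omega)
        refine ⟨f, hf, fun ζ hζ => ?_⟩
        have h1 : ζ ^ (m j - m i) * ζ ^ (m i - m j).toNat = 1 := by
          rw [← zpow_natCast, Int.toNat_of_nonneg (by omega), ← zpow_add₀ hζ]
          simp
        rw [he, pow_succ]
        calc _ = (ζ ^ (m j - m i) * ζ ^ (m i - m j).toNat) * (ζ⁻¹ * ζ) * f ζ := by ring
          _ = _ := by rw [h1, inv_mul_cancel₀ hζ]; ring
  choose f hf he using hentry
  refine ⟨fun ζ => Matrix.of fun i j => f i j ζ, fun i j => hf i j, ?_⟩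
  filter_upwards [hP.2, self_mem_nhdsWithin] with ζ hζ hζ0
  have hζ0 : ζ ≠ 0 := hζ0
  have hform : formAtInfty A ζ = powMat (fun j => -m j) ζ *
      (connAtInfty m A ζ + ζ⁻¹ • splitMat m) * powMat m ζ := by
    rw [connAtInfty, sub_add_cancel]
    calc formAtInfty A ζ = (powMat (fun j => -m j) ζ * powMat m ζ) * formAtInfty A ζ *
          (powMat (fun j => -m j) ζ * powMat m ζ) := by
          rw [powMat_neg_mul_powMat m hζ0, one_mul, mul_one]
      _ = _ := by simp only [Matrix.mul_assoc]
  ext i j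
  rw [hform, powMat_neg_conj_apply m hζ0, hζ]
  exact he i j ζ hζ0

/-- The residue at infinity of an adapted connection can be made triangular. -/
theorem exists_triangular_gauge {m : Fin r → ℤ} {a : Fin r → ℝ} {σ : Equiv.Perm (Fin r)}
    {A f₁ : ℂ → Mat r} {R : Mat r} (hf₁ : IsHolomorphicAtZero f₁)
    (hA : ∀ᶠ ζ in 𝓝[≠] (0 : ℂ), connAtInfty m A ζ = ζ⁻¹ • R + f₁ ζ)
    {B : GL (Fin r) ℂ} (hR : R = Ad B (weightMat a)) (hσ : InCell m σ (flagOfFrame B)) :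
    ∃ (g : BundleAut m) (P : ℂ → Mat r), IsGermAtInfty m (g.act A) P ∧
      IsTriangularGerm a σ P := by
  obtain ⟨p, hp, hF⟩ := hσ
  have hP : IsGermAtInfty m A fun ζ => R + ζ • f₁ ζ := by
    refine ⟨(isHolomorphicAtZero_const R).add hf₁.smul, ?_⟩
    filter_upwards [hA, self_mem_nhdsWithin] with ζ hζ hζ0
    rw [hζ, smul_add, smul_smul, inv_mul_cancel₀ hζ0, one_smul]
  have hact := (BundleAut.const p⁻¹ hp.inv).isGermAtInfty_act hP
  refine ⟨_, _, hact, ?_⟩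
  -- Two frames of the same flag differ by the lower triangular `U`, so the gauged residue is a
  -- conjugate of the weights by `U`, up to the permutation.
  set U : GL (Fin r) ℂ := (p * permGL σ)⁻¹ * B with hU
  have hUl : IsLower (U : Mat r) := isLower_of_flagOfFrame_eq hF
  have hUl' := hUl.inv
  set T := Ad U (weightMat a) with hTdef
  have hTapp : ∀ i j, T i j =
      ∑ l, (U : Mat r) i l * a l * ((U⁻¹ : GL (Fin r) ℂ) : Mat r) l j := by
    intro i j
    rw [hTdef, Ad, Matrix.mul_apply]
    simp [weightMat, Matrix.mul_diagonal]
  have hres : Ad p⁻¹ R = T.submatrix σ σ := by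
    rw [← Ad_permGL, hTdef, ← Ad_mul, hR, ← Ad_mul, hU]
    congr 1
    group
  have h0 : ∀ i j, taylorCoeff (fun ζ => (Ad ((BundleAut.const p⁻¹ hp.inv).g1 ζ) (R + ζ • f₁ ζ) -
      ζ • (matDeriv (fun u => ((BundleAut.const p⁻¹ hp.inv).g1 u : Mat r)) ζ *
        ((((BundleAut.const p⁻¹ hp.inv).g1 ζ)⁻¹ : GL (Fin r) ℂ) : Mat r))) i j) 0 =
      T (σ i) (σ j) := by
    intro i j
    have h1 : (Ad ((BundleAut.const p⁻¹ hp.inv).g1 0) R) = T.submatrix σ σ := hres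
    simp only [taylorCoeff, zero_smul, add_zero, sub_zero, h1, Matrix.submatrix_apply]
  refine ⟨fun i => ?_, fun i j hij => ?_⟩
  · have hs : ∀ x : Fin r → ℂ,
        ∑ l, (U : Mat r) (σ i) l * x l * ((U⁻¹ : GL (Fin r) ℂ) : Mat r) l (σ i) =
          (U : Mat r) (σ i) (σ i) * x (σ i) * ((U⁻¹ : GL (Fin r) ℂ) : Mat r) (σ i) (σ i) := by
      intro x
      refine Finset.sum_eq_single _ (fun l _ hl => ?_) (by simp)
      rcases lt_or_gt_of_ne hl with h | h
      · rw [isLower_iff.1 hUl' l (σ i) h, mul_zero]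
      · rw [isLower_iff.1 hUl (σ i) l h, zero_mul, zero_mul]
    -- The same collapse of the sum, applied to `x = 1`, shows that the diagonal entries of `U` and
    -- of its inverse are reciprocal.
    have h1 : (U : Mat r) (σ i) (σ i) * ((U⁻¹ : GL (Fin r) ℂ) : Mat r) (σ i) (σ i) = 1 := by
      have := hs fun _ => 1
      simp only [mul_one] at this
      rw [← this, ← Matrix.mul_apply, Units.mul_inv, Matrix.one_apply_eq]
    rw [h0, hTapp, hs fun l => (a l : ℂ)]
    linear_combination (a (σ i) : ℂ) * h1
  · rw [h0, hTapp]
    refine Finset.sum_eq_zero fun l _ => ?_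
    by_cases h : σ i < l
    · rw [isLower_iff.1 hUl (σ i) l h, zero_mul, zero_mul]
    · rw [isLower_iff.1 hUl' l (σ j) (lt_of_le_of_lt (not_lt.1 h) hij), mul_zero]

theorem exists_normalizing_gauge {m : Fin r → ℤ} {a : Fin r → ℝ} {σ : Equiv.Perm (Fin r)}
    (ha : Function.Injective a) (ha01 : ∀ j, 0 ≤ a j ∧ a j < 1)
    {A f₁ : ℂ → Mat r} {R : Mat r} (hf₁ : IsHolomorphicAtZero f₁)
    (hA : ∀ᶠ ζ in 𝓝[≠] (0 : ℂ), connAtInfty m A ζ = ζ⁻¹ • R + f₁ ζ)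
    {B : GL (Fin r) ℂ} (hR : R = Ad B (weightMat a)) (hσ : InCell m σ (flagOfFrame B)) :
    ∃ g : BundleAut m, IsNormalizedAtInfty m a σ (g.act A) := by
  obtain ⟨g, P, hP, hT⟩ := exists_triangular_gauge hf₁ hA hR hσ
  obtain ⟨d, hd⟩ : ∃ d : ℕ, ∀ i j, m i - m j ≤ d := by
    refine ⟨∑ i, ∑ j, (m i - m j).natAbs, fun i j => ?_⟩
    have h1 : (m i - m j).natAbs ≤ ∑ j, (m i - m j).natAbs :=
      Finset.single_le_sum (f := fun j => (m i - m j).natAbs) (fun _ _ => Nat.zero_le _)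
        (Finset.mem_univ j)
    have h2 : ∑ j, (m i - m j).natAbs ≤ ∑ i, ∑ j, (m i - m j).natAbs :=
      Finset.single_le_sum (f := fun i => ∑ j, (m i - m j).natAbs) (fun _ _ => Nat.zero_le _)
        (Finset.mem_univ i)
    omega
  -- An obstructing monomial has `e ≤ d` and positions below `r`, so its degree is less than `d * r
  -- + r`.
  obtain ⟨g', Q, hQ, hQT, hQN⟩ := exists_normalization ha ha01 hP hT (d * r + r)
  refine ⟨g'.mul g, ?_⟩
  rw [BundleAut.act_mul]
  refine hQ.isNormalizedAtInfty hQT fun i j e hij he => hQN i j e hij he (Or.inl ?_)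
  have h1 : (e : ℤ) ≤ d := he.trans (hd i j)
  have h2 : (e : ℤ) * r ≤ d * r := by gcongr
  have h3 := (σ i).isLt
  simp only [weightDeg]
  push_cast
  omega

end RHGauge

/-! ### The Riemann–Hilbert gauge -/

theorem mainTheorem7 {r k : ℕ} (m : Fin r → ℤ) (hm : Monotone m)
    (z : Fin k → ℂ) (hz : Function.Injective z)
    (α : Fin (k + 1) → Fin r → ℝ) (hα : ∀ i, StrictMono (α i))
    (hα01 : ∀ i j, 0 ≤ α i j ∧ α i j < 1)
    (F : Fin (k + 1) → RHGauge.CompleteFlag r) (A : ℂ → RHGauge.Mat r)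
    (hA : RHGauge.IsAdaptedConnection m z α F A) (x₀ : RHGauge.Punctured z) :
    (∃ σ : Equiv.Perm (Fin r), RHGauge.InCell m σ (F (Fin.last k))) ∧
    ∀ σ : Equiv.Perm (Fin r), RHGauge.InCell m σ (F (Fin.last k)) →
      (∃ g : RHGauge.BundleAut m,
        RHGauge.IsNormalizedAtInfty m (α (Fin.last k)) σ (g.act A)) ∧
      (∀ g g' : RHGauge.BundleAut m,
        RHGauge.IsNormalizedAtInfty m (α (Fin.last k)) σ (g.act A) →
        RHGauge.IsNormalizedAtInfty m (α (Fin.last k)) σ (g'.act A) →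
        ∃ d : Fin r → ℂ, (∀ j, d j ≠ 0) ∧
          ∀ w, (g'.g0 w : RHGauge.Mat r) = Matrix.diagonal d * (g.g0 w : RHGauge.Mat r)) ∧
      ∀ g : RHGauge.BundleAut m,
        RHGauge.IsNormalizedAtInfty m (α (Fin.last k)) σ (g.act A) →
        RHGauge.IsAdaptedConnection m z α (g.actFlags z F) (g.act A) ∧
        (∃ R : Fin k → RHGauge.Mat r, RHGauge.IsFuchsianSystem z (g.act A) R ∧
          ∑ i, R i = -RHGauge.normalResidue m (α (Fin.last k)) σ) ∧
        ∃ ρ : FundamentalGroup (RHGauge.Punctured z) x₀ →* GL (Fin r) ℂ,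
          RHGauge.IsMonodromyRep z A x₀ ρ ∧
          RHGauge.IsMonodromyRep z (g.act A) x₀
            ((MulAut.conj (g.g0 x₀)).toMonoidHom.comp ρ) := by
  obtain ⟨R, ⟨f₀, hf₀, h0⟩, ⟨f₁, hf₁, h1⟩, hB⟩ := id hA
  obtain ⟨B, hR, hF⟩ := hB (Fin.last k)
  have ha := (hα (Fin.last k)).injective
  have ha01 := hα01 (Fin.last k)
  refine ⟨by rw [hF]; exact RHGauge.exists_inCell hm B, fun σ hσ => ⟨?_, ?_, fun g hg => ?_⟩⟩
  · exact RHGauge.exists_normalizing_gauge ha ha01 hf₁ h1 hR (hF ▸ hσ)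
  · exact fun g g' hg hg' => g.normalizing_unique g' ha ha01 hg hg'
  · refine ⟨g.isAdaptedConnection_act hA, ?_, ?_⟩
    · obtain ⟨f, hf, hAf⟩ := g.act_pole_expansion hf₀ h0
      obtain ⟨f', hf', hAf'⟩ := hg
      exact ⟨_, RHGauge.isFuchsianSystem_of_formAtInfty hf hAf hf' hAf'⟩
    · have han : ∀ c : RHGauge.Punctured z, ∀ i j, AnalyticAt ℂ (fun w => A w i j) c := by
        intro c i j
        have hopen : IsOpen (Set.range z)ᶜ := (Set.finite_range z).isClosed.isOpen_compl
        have hev : (fun w => (∑ l : Fin k, (w - z l)⁻¹ • R l.castSucc + f₀ w) i j)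
            =ᶠ[𝓝 (c : ℂ)] fun w => A w i j := by
          filter_upwards [hopen.mem_nhds c.2] with w hw
          rw [h0 w hw]
        refine AnalyticAt.congr ?_ hev
        simp only [Matrix.add_apply, Matrix.sum_apply, Matrix.smul_apply, smul_eq_mul]
        refine (Finset.analyticAt_fun_sum _ fun l _ => ?_).add ((hf₀ i j).analyticAt _)
        have hne : (c : ℂ) - z l ≠ 0 := sub_ne_zero.2 fun e => c.2 ⟨l, e.symm⟩
        exact ((analyticAt_id.sub analyticAt_const).inv hne).mul analyticAt_const
      obtain ⟨ρ, hρ⟩ := RHGauge.exists_isMonodromyRep han x₀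
      exact ⟨ρ, hρ, g.isMonodromyRep_act hρ⟩
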